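/- \textbf{Theorem (Error propagation under the reduction).} \emph{Hypergraph product.} Let $H_1\in\mathbb F_2^{m_1\times n_1}$ and $H_2\in\mathbb F_2^{m_2\times n_2}$ have full row rank, and let $$H_X=(H_1\otimes 1\mid 1\otimes H_2^{\mathsf T}),\qquad H_Z=(1\otimes H_2\mid H_1^{\mathsf T}\otimes 1)$$ be the check matrices of their hypergraph product. Its data qubits are the bit-type qubits $(i,j)\in[n_1]\times[n_2]$ and the check-type qubits $(a,b)\in[m_1]\times[m_2]$; the first index is the row, the second the column. Its $X$-checks are labelled by $[m_1]\times[n_2]$, its $Z$-checks by $[n_1]\times[m_2]$. \emph{Reduction.} Properly colour the check-adjacency graphs of $H_1$ and $H_2$ (two checks are adjacent if they share a bit) with $\chi_1$ and $\chi_2$ colours; this partitions the check-type qubits into product colour groups $\Gamma_{i,j}$. Choose disjoint sets $\Gamma^{(X)},\Gamma^{(Z)}$ of groups, with at most one group of $\Gamma^{(X)}$ for each $i$ and at most one group of $\Gamma^{(Z)}$ for each $j$. For each check-type qubit in a group of $\Gamma^{(X)}$ (of $\Gamma^{(Z)}$), enumerate the $\Delta$ $X$-checks ($Z$-checks) acting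 on it in any order and replace them by the $\Delta-1$ products of consecutive ones (the combined checks); then delete the qubit. All other checks are kept (restricted to the remaining qubits). The resulting CSS code $\widetilde{\mathcal Q}$, with check matrices $\widetilde H_X,\widetilde H_Z$, is the reduced HGP code. \emph{Split schedule.} A combined $X$-check acts on bit-type qubits of exactly two columns; call one of them first and the other second, arbitrarily. Divide the edges of the Tanner graph of $\widetilde H_X$ into three stages: (1) all edges of the non-combined checks and the edges of the combined checks into their first column; (2) the edges of the combined checks to check-type qubits; (3) the edges of the combined checks into their second column. Properly edge-colour the graph of each stage. The split $X$-circuit runs through the stages in order and, in each stage, through the colours, applying at once the CNOTs from the syndrome qubit of the check to the data qubit for all edges of that stage and colour; the syndrome qubits (one for each check) are prepared in $|+\rangle$ and measured in the $X$ basis. The split $Z$-circuit is defined in the same way with rows in place of columns, CNOTs from data to syndrome qubits, and preparation and measurement in the $Z$ basis. \emph{Distances.} An error on the data qubits is undetectable if it commutes with all checks but is not (up to phase) in the stabilizer group. The code distance $d(\widetilde{\mathcal Q})$ is the minimum weight of an undetectable error. The effective distance $d_{\rm eff}(U)$ of a syndrome-extraction circuit $U$ is the minimum number of single-qubit Pauli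 errors, on data and syndrome qubits at any time steps of $U$, such that the resulting data error at the end of $U$ is undetectable. (Both are $\infty$ if there is no undetectable error.) \emph{Claim.} For every such reduction, split $X$- and $Z$-schedules exist, also with each stage coloured by the minimum number of colours. For all of them, the circuit $U$ that runs the split $X$-circuit followed by the split $Z$-circuit, or the two in the other order, is a single-ancilla syndrome-extraction circuit that measures all checks of $\widetilde{\mathcal Q}$, and it is distance-preserving: $$d_{\rm eff}(U)=d(\widetilde{\mathcal Q}).$$ Moreover, a Pauli error on the syndrome qubit of an $X$-check ($Z$-check) $c$, at any time step, results in a purely $X$-type ($Z$-type) data error which, either as it is or after multiplication by the check $c$, meets the bit-type qubits in a single column (row). -/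

import Mathlib

open Matrix
open scoped Kronecker

namespace HGPReduction

/-! ### Pauli operators, CSS codes, code distance -/

/-- A Pauli operator on the qubits `ι`, up to a phase, in binary symplectic form: the pair
`(x, z)` stands for the product of `X_i ^ (x i) * Z_i ^ (z i)` over all qubits `i`. Multiplication
of Pauli operators up to a phase is addition of pairs. -/
abbrev Pauli (ι : Type*) : Type _ := (ι → ZMod 2) × (ι → ZMod 2)

/-- The number of qubits on which a Pauli operator acts nontrivially (by `X`, `Y` or `Z`). -/
def weight {ι : Type*} [Fintype ι] (P : Pauli ι) : ℕ :=
  (Finset.univ.filter fun i => P.1 i ≠ 0 ∨ P.2 i ≠ 0).card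

/-- A CSS stabilizer code given by its `X`-type and `Z`-type check operators. -/
structure CSSCode (Q CX CZ : Type*) [Fintype Q] where
  HX : Matrix CX Q (ZMod 2)
  HZ : Matrix CZ Q (ZMod 2)
  comm : HX * HZᵀ = 0

namespace CSSCode

variable {Q CX CZ : Type*} [Fintype Q]

/-- Membership in the stabilizer group (up to phase). -/
def IsStabilizer (C : CSSCode Q CX CZ) (P : Pauli Q) : Prop :=
  P.1 ∈ Submodule.span (ZMod 2) (Set.range C.HX.row) ∧
    P.2 ∈ Submodule.span (ZMod 2) (Set.range C.HZ.row)

/-- A harmful undetectable error: it commutes with every check but is not itself a stabilizer,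
that is, it is a nontrivial logical operator. -/
def Undetectable (C : CSSCode Q CX CZ) (P : Pauli Q) : Prop :=
  C.HZ *ᵥ P.1 = 0 ∧ C.HX *ᵥ P.2 = 0 ∧ ¬ C.IsStabilizer P

/-- The code distance: the minimum weight of a nontrivial logical operator
(`⊤` if the code encodes no qubit). -/
noncomputable def distance (C : CSSCode Q CX CZ) : ℕ∞ :=
  ⨅ (P : Pauli Q) (_ : C.Undetectable P), (weight P : ℕ∞)

end CSSCode

/-! ### CNOT circuits and error propagation -/

/-- A circuit of CNOT gates, as a list of time steps; a time step is a set of gates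
`(control, target)` that are applied simultaneously. -/
abbrev Circuit (ι : Type*) : Type _ := List (Finset (ι × ι))

/-- Each gate acts on two different qubits and gates of one time step act on disjoint qubits. -/
def Circuit.WellFormed {ι : Type*} (U : Circuit ι) : Prop :=
  ∀ L ∈ U, (∀ g ∈ L, g.1 ≠ g.2) ∧
    ∀ g ∈ L, ∀ g' ∈ L, g ≠ g' →
      g.1 ≠ g'.1 ∧ g.1 ≠ g'.2 ∧ g.2 ≠ g'.1 ∧ g.2 ≠ g'.2

/-- Conjugation of a Pauli operator by one time step: each CNOT copies `X` from its control to
its target and `Z` from its target to its control. -/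
def propagateStep {ι : Type*} [DecidableEq ι] (L : Finset (ι × ι)) (P : Pauli ι) : Pauli ι :=
  (fun i => P.1 i + ∑ g ∈ L with g.2 = i, P.1 g.1,
   fun i => P.2 i + ∑ g ∈ L with g.1 = i, P.2 g.2)

/-- Conjugation of a Pauli operator by a circuit (the head of the list acts first). -/
def propagate {ι : Type*} [DecidableEq ι] (U : Circuit ι) (P : Pauli ι) : Pauli ι :=
  U.foldl (fun P' L => propagateStep L P') P

/-- A fault pattern `F` of a circuit with `T` time steps consists of the Pauli errors `F t` that
hit the qubits after the first `t` time steps, for `0 ≤ t ≤ T`. This is the number of its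
single-qubit errors. -/
def faultCount {ι : Type*} [Fintype ι] {T : ℕ} (F : Fin (T + 1) → Pauli ι) : ℕ :=
  ∑ t, weight (F t)

/-- The error at the end of the circuit `U` that is caused by the fault pattern `F`: each fault is
propagated through the rest of the circuit. -/
def finalError {ι : Type*} [DecidableEq ι] (U : Circuit ι)
    (F : Fin (U.length + 1) → Pauli ι) : Pauli ι :=
  ∑ t : Fin (U.length + 1), propagate (U.drop t) (F t)

/-- The qubits of a single-ancilla syndrome-extraction circuit: the data qubits and one
syndrome qubit for each `X`-check and each `Z`-check. -/
abbrev Wire (Q CX CZ : Type*) : Type _ := Q ⊕ (CX ⊕ CZ)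

/-- The restriction of an error to the data qubits. -/
def dataPart {Q A : Type*} (P : Pauli (Q ⊕ A)) : Pauli Q :=
  (fun q => P.1 (Sum.inl q), fun q => P.2 (Sum.inl q))

namespace CSSCode

variable {Q CX CZ : Type*} [Fintype Q] [Fintype CX] [Fintype CZ]
  [DecidableEq Q] [DecidableEq CX] [DecidableEq CZ]

/-- The circuit measures every check on its own syndrome qubit. The syndrome qubit of an
`X`-check (`Z`-check) is prepared in the `+1` eigenstate of `X` (of `Z`) and finally measured in
the same basis; in the Heisenberg picture, the circuit takes the check operator times the `X`
(`Z`) of its syndrome qubit to the `X` (`Z`) of the syndrome qubit alone. -/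
def IsSyndromeExtraction (C : CSSCode Q CX CZ) (U : Circuit (Wire Q CX CZ)) : Prop :=
  U.WellFormed ∧
  (∀ c : CX, propagate U (Sum.elim (C.HX c) (Pi.single (Sum.inl c) 1), 0) =
    (Sum.elim (0 : Q → ZMod 2) (Pi.single (Sum.inl c) 1), 0)) ∧
  (∀ c : CZ, propagate U (0, Sum.elim (C.HZ c) (Pi.single (Sum.inr c) 1)) =
    (0, Sum.elim (0 : Q → ZMod 2) (Pi.single (Sum.inr c) 1)))

/-- The effective distance: the minimum number of single-qubit errors, on data and syndrome
qubits at any time of the circuit, whose resulting data error is undetectable. -/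
noncomputable def effectiveDistance (C : CSSCode Q CX CZ) (U : Circuit (Wire Q CX CZ)) : ℕ∞ :=
  ⨅ (F : Fin (U.length + 1) → Pauli (Wire Q CX CZ))
    (_ : C.Undetectable (dataPart (finalError U F))), (faultCount F : ℕ∞)

/-- A distance-preserving syndrome-extraction circuit. -/
def IsDistancePreserving (C : CSSCode Q CX CZ) (U : Circuit (Wire Q CX CZ)) : Prop :=
  C.IsSyndromeExtraction U ∧ C.effectiveDistance U = C.distance

end CSSCode

/-! ### The hypergraph product code and its reduction -/

variable {m₁ n₁ m₂ n₂ : ℕ}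

/-- `X`-type parity-check matrix of the hypergraph product. -/
def hgpX (H₁ : Matrix (Fin m₁) (Fin n₁) (ZMod 2)) (H₂ : Matrix (Fin m₂) (Fin n₂) (ZMod 2)) :
    Matrix (Fin m₁ × Fin n₂) (Fin n₁ × Fin n₂ ⊕ Fin m₁ × Fin m₂) (ZMod 2) :=
  Matrix.fromCols (H₁ ⊗ₖ (1 : Matrix (Fin n₂) (Fin n₂) (ZMod 2)))
    ((1 : Matrix (Fin m₁) (Fin m₁) (ZMod 2)) ⊗ₖ H₂ᵀ)

/-- `Z`-type parity-check matrix of the hypergraph product. -/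
def hgpZ (H₁ : Matrix (Fin m₁) (Fin n₁) (ZMod 2)) (H₂ : Matrix (Fin m₂) (Fin n₂) (ZMod 2)) :
    Matrix (Fin n₁ × Fin m₂) (Fin n₁ × Fin n₂ ⊕ Fin m₁ × Fin m₂) (ZMod 2) :=
  Matrix.fromCols ((1 : Matrix (Fin n₁) (Fin n₁) (ZMod 2)) ⊗ₖ H₂)
    (H₁ᵀ ⊗ₖ (1 : Matrix (Fin m₂) (Fin m₂) (ZMod 2)))

/-- The check-adjacency graph: two checks are adjacent if they share a bit. -/
def checkAdjacency {m n : ℕ} (H : Matrix (Fin m) (Fin n) (ZMod 2)) : SimpleGraph (Fin m) where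
  Adj c c' := c ≠ c' ∧ ∃ b, H c b ≠ 0 ∧ H c' b ≠ 0
  symm := ⟨fun _ _ h => ⟨h.1.symm, h.2.imp fun _ hb => ⟨hb.2, hb.1⟩⟩⟩
  loopless := ⟨fun _ h => h.1 rfl⟩

/-- The bits in the support of a classical check. -/
abbrev Supp {m n : ℕ} (H : Matrix (Fin m) (Fin n) (ZMod 2)) (c : Fin m) : Type :=
  {b : Fin n // H c b ≠ 0}

/-- The choices that determine a run of the reduction procedure. -/
structure Reduction (H₁ : Matrix (Fin m₁) (Fin n₁) (ZMod 2))
    (H₂ : Matrix (Fin m₂) (Fin n₂) (ZMod 2)) where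
  /-- Numbers of colors. -/
  χ₁ : ℕ
  χ₂ : ℕ
  /-- Proper colorings of the check-adjacency graphs. -/
  col₁ : (checkAdjacency H₁).Coloring (Fin χ₁)
  col₂ : (checkAdjacency H₂).Coloring (Fin χ₂)
  /-- The product color groups in which `X`-checks, respectively `Z`-checks, are combined. -/
  groupsX : Finset (Fin χ₁ × Fin χ₂)
  groupsZ : Finset (Fin χ₁ × Fin χ₂)
  /-- At most one `X`-group per row, at most one `Z`-group per column, no group is both. -/
  groupsX_row : ∀ i j j', (i, j) ∈ groupsX → (i, j') ∈ groupsX → j = j'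
  groupsZ_col : ∀ i i' j, (i, j) ∈ groupsZ → (i', j) ∈ groupsZ → i = i'
  groups_disjoint : Disjoint groupsX groupsZ
  /-- For each check-type qubit, an enumeration of the neighboring `X`-checks and `Z`-checks. -/
  ordX : ∀ c : Fin m₁ × Fin m₂, Fin (Fintype.card (Supp H₂ c.2)) ≃ Supp H₂ c.2
  ordZ : ∀ c : Fin m₁ × Fin m₂, Fin (Fintype.card (Supp H₁ c.1)) ≃ Supp H₁ c.1

namespace Reduction

variable {H₁ : Matrix (Fin m₁) (Fin n₁) (ZMod 2)} {H₂ : Matrix (Fin m₂) (Fin n₂) (ZMod 2)}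
variable (R : Reduction H₁ H₂)

/-- The check-type qubit `c` is removed by combining `X`-checks. -/
abbrev InX (c : Fin m₁ × Fin m₂) : Prop := (R.col₁ c.1, R.col₂ c.2) ∈ R.groupsX

/-- The check-type qubit `c` is removed by combining `Z`-checks. -/
abbrev InZ (c : Fin m₁ × Fin m₂) : Prop := (R.col₁ c.1, R.col₂ c.2) ∈ R.groupsZ

/-- The original `X`-check `d` touches a check-type qubit at which `X`-checks are combined. -/
abbrev MergedX (d : Fin m₁ × Fin n₂) : Prop := ∃ c₂, R.InX (d.1, c₂) ∧ H₂ c₂ d.2 ≠ 0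

/-- The original `Z`-check `d` touches a check-type qubit at which `Z`-checks are combined. -/
abbrev MergedZ (d : Fin n₁ × Fin m₂) : Prop := ∃ c₁, R.InZ (c₁, d.2) ∧ H₁ c₁ d.1 ≠ 0

/-- The combined `X`-checks: a qubit with `Δ` neighboring `X`-checks yields `Δ - 1` of them. -/
abbrev CombX : Type :=
  Σ c : {c : Fin m₁ × Fin m₂ // R.InX c}, Fin (Fintype.card (Supp H₂ c.1.2) - 1)

/-- The combined `Z`-checks. -/
abbrev CombZ : Type :=
  Σ c : {c : Fin m₁ × Fin m₂ // R.InZ c}, Fin (Fintype.card (Supp H₁ c.1.1) - 1)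

/-- All `X`-checks of the reduced code: the untouched ones and the combined ones. -/
abbrev CheckX : Type := {d : Fin m₁ × Fin n₂ // ¬ R.MergedX d} ⊕ R.CombX

/-- All `Z`-checks of the reduced code. -/
abbrev CheckZ : Type := {d : Fin n₁ × Fin m₂ // ¬ R.MergedZ d} ⊕ R.CombZ

/-- The data qubits of the reduced code: all bit-type qubits and the check-type qubits kept. -/
abbrev Qubit : Type :=
  Fin n₁ × Fin n₂ ⊕ {c : Fin m₁ × Fin m₂ // ¬ (R.InX c ∨ R.InZ c)}

instance : DecidableEq R.CombX := instDecidableEqSigma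
instance : DecidableEq R.CombZ := instDecidableEqSigma
instance : DecidableEq R.CheckX := instDecidableEqSum
instance : DecidableEq R.CheckZ := instDecidableEqSum
instance : DecidableEq R.Qubit := instDecidableEqSum

theorem index_lt {n : ℕ} (k : Fin (n - 1)) (s : Bool) : k.1 + s.toNat < n := by
  have := k.2
  have := s.toNat_le
  omega

/-- The two columns of the combined `X`-check `r` (`s = false`: first, `s = true`: second). -/
def colOf (r : R.CombX) (s : Bool) : Fin n₂ :=
  (R.ordX r.1.1 ⟨r.2.1 + s.toNat, index_lt r.2 s⟩).1

/-- The two rows of the combined `Z`-check `r`. -/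
def rowOf (r : R.CombZ) (s : Bool) : Fin n₁ :=
  (R.ordZ r.1.1 ⟨r.2.1 + s.toNat, index_lt r.2 s⟩).1

/-- The matrix of the linear combinations of `X`-checks: identity on untouched checks, and the
repetition-code parity-check matrix on the checks around each qubit removed. -/
def WX : Matrix R.CheckX (Fin m₁ × Fin n₂) (ZMod 2) := Matrix.of fun
  | Sum.inl d => Pi.single d.1 1
  | Sum.inr r => Pi.single (r.1.1.1, R.colOf r false) 1 + Pi.single (r.1.1.1, R.colOf r true) 1

/-- The matrix of the linear combinations of `Z`-checks. -/
def WZ : Matrix R.CheckZ (Fin n₁ × Fin m₂) (ZMod 2) := Matrix.of fun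
  | Sum.inl d => Pi.single d.1 1
  | Sum.inr r => Pi.single (R.rowOf r false, r.1.1.2) 1 + Pi.single (R.rowOf r true, r.1.1.2) 1

/-- The selection of the qubits kept. -/
def V : Matrix (Fin n₁ × Fin n₂ ⊕ Fin m₁ × Fin m₂) R.Qubit (ZMod 2) :=
  (1 : Matrix (Fin n₁ × Fin n₂ ⊕ Fin m₁ × Fin m₂) _ (ZMod 2)).submatrix id
    (Sum.map id Subtype.val)

theorem two_nonzero {a b : ZMod 2} (ha : a ≠ 0) (hb : b ≠ 0) : a + b = 0 := by
  revert a b; decide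

theorem ord_nonzero_X (r : R.CombX) (s : Bool) : H₂ r.1.1.2 (R.colOf r s) ≠ 0 :=
  (R.ordX r.1.1 _).2

theorem ord_nonzero_Z (r : R.CombZ) (s : Bool) : H₁ r.1.1.1 (R.rowOf r s) ≠ 0 :=
  (R.ordZ r.1.1 _).2

/-- Combining cleans the `X`-checks off the qubits of the `X`-groups. -/
theorem clean_X (r : R.CheckX) (c : Fin m₁ × Fin m₂) (hc : R.InX c) :
    (R.WX * hgpX H₁ H₂) r (Sum.inr c) = 0 := by
  rcases r with d | r
  · have : (R.WX * hgpX H₁ H₂) (Sum.inl d) (Sum.inr c) = hgpX H₁ H₂ d.1 (Sum.inr c) := by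
      simp [Matrix.mul_apply, WX, Pi.single_apply]
    rw [this]
    by_contra h
    simp only [hgpX, fromCols_apply_inr, kroneckerMap_apply, transpose_apply, one_apply] at h
    split_ifs at h with h1
    · exact d.2 ⟨c.2, by simpa [InX, h1] using hc, by simpa using h⟩
    · simp at h
  · have : (R.WX * hgpX H₁ H₂) (Sum.inr r) (Sum.inr c) =
        hgpX H₁ H₂ (r.1.1.1, R.colOf r false) (Sum.inr c) +
          hgpX H₁ H₂ (r.1.1.1, R.colOf r true) (Sum.inr c) := by
      simp [Matrix.mul_apply, WX, Pi.single_apply, add_mul, Finset.sum_add_distrib]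
    rw [this]
    simp only [hgpX, fromCols_apply_inr, kroneckerMap_apply, transpose_apply, one_apply]
    split_ifs with h1
    · have hcol : R.col₂ r.1.1.2 = R.col₂ c.2 :=
        R.groupsX_row (R.col₁ c.1) _ _ (by simpa [InX, h1] using r.1.2) hc
      by_cases h2 : r.1.1.2 = c.2
      · rw [← h2, one_mul, one_mul]
        exact two_nonzero (R.ord_nonzero_X r false) (R.ord_nonzero_X r true)
      · have key : ∀ s, H₂ c.2 (R.colOf r s) = 0 := fun s => by
          by_contra h3
          exact R.col₂.valid (v := r.1.1.2) (w := c.2)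
            ⟨h2, _, R.ord_nonzero_X r s, h3⟩ hcol
        simp [key]
    · simp

/-- Combining cleans the `Z`-checks off the qubits of the `Z`-groups. -/
theorem clean_Z (r : R.CheckZ) (c : Fin m₁ × Fin m₂) (hc : R.InZ c) :
    (R.WZ * hgpZ H₁ H₂) r (Sum.inr c) = 0 := by
  rcases r with d | r
  · have : (R.WZ * hgpZ H₁ H₂) (Sum.inl d) (Sum.inr c) = hgpZ H₁ H₂ d.1 (Sum.inr c) := by
      simp [Matrix.mul_apply, WZ, Pi.single_apply]
    rw [this]
    by_contra h
    simp only [hgpZ, fromCols_apply_inr, kroneckerMap_apply, transpose_apply, one_apply] at h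
    split_ifs at h with h1
    · exact d.2 ⟨c.1, by simpa [InZ, h1] using hc, by simpa using h⟩
    · simp at h
  · have : (R.WZ * hgpZ H₁ H₂) (Sum.inr r) (Sum.inr c) =
        hgpZ H₁ H₂ (R.rowOf r false, r.1.1.2) (Sum.inr c) +
          hgpZ H₁ H₂ (R.rowOf r true, r.1.1.2) (Sum.inr c) := by
      simp [Matrix.mul_apply, WZ, Pi.single_apply, add_mul, Finset.sum_add_distrib]
    rw [this]
    simp only [hgpZ, fromCols_apply_inr, kroneckerMap_apply, transpose_apply, one_apply]
    split_ifs with h1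
    · have hcol : R.col₁ r.1.1.1 = R.col₁ c.1 :=
        R.groupsZ_col _ _ (R.col₂ c.2) (by simpa [InZ, h1] using r.1.2) hc
      by_cases h2 : r.1.1.1 = c.1
      · rw [← h2, mul_one, mul_one]
        exact two_nonzero (R.ord_nonzero_Z r false) (R.ord_nonzero_Z r true)
      · have key : ∀ s, H₁ c.1 (R.rowOf r s) = 0 := fun s => by
          by_contra h3
          exact R.col₁.valid (v := r.1.1.1) (w := c.1)
            ⟨h2, _, R.ord_nonzero_Z r s, h3⟩ hcol
        simp [key]
    · simp

theorem hgp_comm (H₁ : Matrix (Fin m₁) (Fin n₁) (ZMod 2))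
    (H₂ : Matrix (Fin m₂) (Fin n₂) (ZMod 2)) : hgpX H₁ H₂ * (hgpZ H₁ H₂)ᵀ = 0 := by
  rw [hgpX, hgpZ, transpose_fromCols, fromCols_mul_fromRows, ← kroneckerMap_transpose,
    ← kroneckerMap_transpose, ← mul_kronecker_mul, ← mul_kronecker_mul]
  simp only [transpose_one, transpose_transpose, Matrix.one_mul, Matrix.mul_one]
  ext i j
  exact CharTwo.add_self_eq_zero _

/-- The reduced hypergraph product code. -/
def code : CSSCode R.Qubit R.CheckX R.CheckZ where
  HX := R.WX * hgpX H₁ H₂ * R.V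
  HZ := R.WZ * hgpZ H₁ H₂ * R.V
  comm := by
    have h0 : (R.WX * hgpX H₁ H₂) * (R.WZ * hgpZ H₁ H₂)ᵀ = 0 := by
      rw [transpose_mul, Matrix.mul_assoc, ← Matrix.mul_assoc (hgpX H₁ H₂), hgp_comm]
      simp
    ext r s
    have h1 := congrFun (congrFun h0 r) s
    have hA := R.clean_X r
    have hB := R.clean_Z s
    generalize R.WX * hgpX H₁ H₂ = A at *
    generalize R.WZ * hgpZ H₁ H₂ = B at *
    have hV : ∀ {α : Type} (M : Matrix α (Fin n₁ × Fin n₂ ⊕ Fin m₁ × Fin m₂) (ZMod 2)) i q,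
        (M * R.V) i q = M i (Sum.map id Subtype.val q) := by
      intro α M i q
      simp [V, Matrix.mul_apply, Matrix.one_apply]
    simp only [Matrix.mul_apply, transpose_apply, Matrix.zero_apply, Fintype.sum_sum_type] at h1
    simp only [Matrix.mul_apply (M := A * R.V), transpose_apply, hV, Matrix.zero_apply,
      Fintype.sum_sum_type, Sum.map_inl, Sum.map_inr, id]
    rw [← h1]
    congr 1
    rw [← Finset.sum_subtype (Finset.univ.filter fun c => ¬ (R.InX c ∨ R.InZ c)) (by simp)
      (fun c => A r (Sum.inr c) * B s (Sum.inr c))]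
    refine Finset.sum_filter_of_ne fun c _ hne hc => hne ?_
    rcases hc with hc | hc
    · rw [hA c hc, zero_mul]
    · rw [hB c hc, mul_zero]

end Reduction

/-! ### The split schedule -/

/-- `f` is a proper coloring, with colors `0, …, k - 1`, of the set `E` of edges of a Tanner
graph (an edge joins a check and a qubit). -/
def IsEdgeColoring {C Q : Type*} (E : Finset (C × Q)) (k : ℕ) (f : C × Q → ℕ) : Prop :=
  (∀ e ∈ E, f e < k) ∧
    ∀ e ∈ E, ∀ e' ∈ E, e ≠ e' → (e.1 = e'.1 ∨ e.2 = e'.2) → f e ≠ f e'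

/-- The edges of the Tanner graph of `H` in the stage `α` (one of `0, 1, 2`). -/
def stageEdges {C Q : Type*} [Fintype C] [Fintype Q] (H : Matrix C Q (ZMod 2))
    (stage : C → Q → Fin 3) (α : Fin 3) : Finset (C × Q) :=
  Finset.univ.filter fun e => H e.1 e.2 ≠ 0 ∧ stage e.1 e.2 = α

/-- A proper edge coloring of each of the three stages. -/
structure StageColoring {C Q : Type*} [Fintype C] [Fintype Q] (H : Matrix C Q (ZMod 2))
    (stage : C → Q → Fin 3) where
  num : Fin 3 → ℕ
  color : Fin 3 → C × Q → ℕ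
  proper : ∀ α, IsEdgeColoring (stageEdges H stage α) (num α) (color α)

/-- Each stage is colored with as few colors as possible. -/
def StageColoring.IsMinimum {C Q : Type*} [Fintype C] [Fintype Q] {H : Matrix C Q (ZMod 2)}
    {stage : C → Q → Fin 3} (S : StageColoring H stage) : Prop :=
  ∀ α k f, IsEdgeColoring (stageEdges H stage α) k f → S.num α ≤ k

/-- The circuit that runs through the three stages in order, and in each stage through the colors,
applying simultaneously the gates on all edges of the current stage and color. -/
def StageColoring.circuit {C Q ι : Type*} [Fintype C] [Fintype Q] [DecidableEq ι]
    {H : Matrix C Q (ZMod 2)} {stage : C → Q → Fin 3} (S : StageColoring H stage)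
    (gate : C × Q → ι × ι) : Circuit ι :=
  (List.finRange 3).flatMap fun α => (List.range (S.num α)).map fun ξ =>
    ((stageEdges H stage α).filter fun e => S.color α e = ξ).image gate

namespace Reduction

variable {H₁ : Matrix (Fin m₁) (Fin n₁) (ZMod 2)} {H₂ : Matrix (Fin m₂) (Fin n₂) (ZMod 2)}
variable (R : Reduction H₁ H₂)

/-- The stages of the split `X`-schedule. Stage `0`: all edges of the untouched checks and the
edges of the combined checks into their first bit-type column; stage `1`: the edges of the
combined checks to check-type qubits; stage `2`: their edges into the second bit-type column.
`flip r` says which of the two columns of `r` comes first. -/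
def stageX (flip : R.CombX → Bool) : R.CheckX → R.Qubit → Fin 3
  | Sum.inl _, _ => 0
  | Sum.inr r, Sum.inl q => if q.2 = R.colOf r (flip r) then 0 else 2
  | Sum.inr _, Sum.inr _ => 1

/-- The stages of the split `Z`-schedule, with rows in place of columns. -/
def stageZ (flip : R.CombZ → Bool) : R.CheckZ → R.Qubit → Fin 3
  | Sum.inl _, _ => 0
  | Sum.inr r, Sum.inl q => if q.1 = R.rowOf r (flip r) then 0 else 2
  | Sum.inr _, Sum.inr _ => 1

/-- A split `X`-schedule: an order of the two columns of each combined check, and edge colorings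
of the three stages. -/
structure SplitX where
  flip : R.CombX → Bool
  coloring : StageColoring R.code.HX (R.stageX flip)

/-- A split `Z`-schedule. -/
structure SplitZ where
  flip : R.CombZ → Bool
  coloring : StageColoring R.code.HZ (R.stageZ flip)

/-- The split `X`-syndrome extraction: CNOTs from the syndrome qubits to the data qubits. -/
def SplitX.circuit {R : Reduction H₁ H₂} (S : R.SplitX) :
    Circuit (Wire R.Qubit R.CheckX R.CheckZ) :=
  S.coloring.circuit fun e => (Sum.inr (Sum.inl e.1), Sum.inl e.2)

/-- The split `Z`-syndrome extraction: CNOTs from the data qubits to the syndrome qubits. -/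
def SplitZ.circuit {R : Reduction H₁ H₂} (S : R.SplitZ) :
    Circuit (Wire R.Qubit R.CheckX R.CheckZ) :=
  S.coloring.circuit fun e => (Sum.inl e.2, Sum.inr (Sum.inr e.1))

/-- Any Pauli error on the syndrome qubit of an `X`-check `c`, at any time `t` of `U`, leads to an
`X`-type data error which, possibly after multiplication by the check `c`, meets the bit-type
qubits in a single column only. -/
def HooksInColumn (U : Circuit (Wire R.Qubit R.CheckX R.CheckZ)) : Prop :=
  ∀ (c : R.CheckX) (t : ℕ) (a b : ZMod 2) (D : Pauli R.Qubit),
    D = dataPart (propagate (U.drop t)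
      (Pi.single (Sum.inr (Sum.inl c)) a, Pi.single (Sum.inr (Sum.inl c)) b)) →
    D.2 = 0 ∧ ∃ x : R.Qubit → ZMod 2, (x = D.1 ∨ x = D.1 + R.code.HX c) ∧
      ∃ j₀ : Fin n₂, ∀ i j, x (Sum.inl (i, j)) ≠ 0 → j = j₀

/-- The same for `Z`-checks, with rows in place of columns. -/
def HooksInRow (U : Circuit (Wire R.Qubit R.CheckX R.CheckZ)) : Prop :=
  ∀ (c : R.CheckZ) (t : ℕ) (a b : ZMod 2) (D : Pauli R.Qubit),
    D = dataPart (propagate (U.drop t)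
      (Pi.single (Sum.inr (Sum.inr c)) a, Pi.single (Sum.inr (Sum.inr c)) b)) →
    D.1 = 0 ∧ ∃ z : R.Qubit → ZMod 2, (z = D.2 ∨ z = D.2 + R.code.HZ c) ∧
      ∃ i₀ : Fin n₁, ∀ i j, z (Sum.inl (i, j)) ≠ 0 → i = i₀

end Reduction

end HGPReduction

open Matrix
open scoped Kronecker

namespace HGPReduction

/-! ### Linear algebra over `ZMod 2` -/

/-! Code distance and fault count are both compared with the weight of a classical codeword. Let x
be the X-part of an undetectable final data error that is not a product of X-checks. By duality some
z commutes with all X-checks and pairs nontrivially with x. Combining X-checks around a removed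
qubit keeps exactly the constraints that do not see its value, so values can be restored on the
qubits of the X-groups that make z satisfy every original X-check (`exists_extension_X`); likewise
for x on the Z-groups. The two sets of qubits are disjoint, so the pairing survives in the unreduced
hypergraph product. There, independence of the rows of `H₁` gives v in ker `H₁` for which w = vᵀx,
formed on the bit-type qubits, is a nonzero codeword of `H₂` (`exists_ker_vecMul_ne_zero`).

The distance is at most |w|: w placed on a single row i with v i ≠ 0 is a nontrivial logical
operator. Conversely |w| is at most the number of faults. The map x ↦ vᵀx kills the bit-type part of
every X-check, and each fault changes at most one entry of w: a data fault stays in its column, and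
a fault on the syndrome qubit of an X-check spreads, up to that check, into one column, because the
first stage of the split schedule covers one column of the check and the later stages the other
(`SplitX.exists_column`). Exchanging rows and columns treats the Z-part. The opposite inequality
places a logical operator after the last gate. -/

theorem eq_one_of_ne_zero {a : ZMod 2} (h : a ≠ 0) : a = 1 := by
  revert a; decide

theorem dotProduct_eq_zero_of_mem_span {C Q : Type*} [Fintype Q] (H : Matrix C Q (ZMod 2))
    {x z : Q → ZMod 2} (hx : x ∈ Submodule.span (ZMod 2) (Set.range H.row))
    (hz : H *ᵥ z = 0) : x ⬝ᵥ z = 0 := by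
  induction hx using Submodule.span_induction with
  | mem y hy =>
    obtain ⟨c, rfl⟩ := hy
    exact congrFun hz c
  | zero => simp
  | add y y' _ _ h h' => simp [add_dotProduct, h, h']
  | smul a y _ h => simp [h]

theorem exists_dotProduct_ne_zero_of_notMem_span {C Q : Type*} [Fintype Q]
    (H : Matrix C Q (ZMod 2)) {x : Q → ZMod 2}
    (hx : x ∉ Submodule.span (ZMod 2) (Set.range H.row)) :
    ∃ z, H *ᵥ z = 0 ∧ x ⬝ᵥ z ≠ 0 := by
  classical
  obtain ⟨f, hf, hle⟩ := Submodule.exists_le_ker_of_notMem hx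
  have hfz : ∀ y, f y = y ⬝ᵥ fun q => f (Pi.single q 1) := fun y => by
    conv_lhs => rw [pi_eq_sum_univ' y]
    simp [dotProduct]
  refine ⟨fun q => f (Pi.single q 1), ?_, by rwa [← hfz]⟩
  ext c
  have h := hle (Submodule.subset_span ⟨c, rfl⟩)
  rw [LinearMap.mem_ker, hfz] at h
  exact h

/-- Two matrix pairs in the kernels of the check maps of a hypergraph product that pair
nontrivially. -/
theorem exists_ker_vecMul_ne_zero {m₁ n₁ m₂ n₂ : Type*} [Fintype m₁] [Fintype n₁] [Fintype m₂]
    [Fintype n₂] (A : Matrix m₁ n₁ (ZMod 2)) (B : Matrix m₂ n₂ (ZMod 2))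
    (hA : LinearIndependent (ZMod 2) A.row)
    (x z : Matrix n₁ n₂ (ZMod 2)) (x' z' : Matrix m₁ m₂ (ZMod 2))
    (hx : x * Bᵀ + Aᵀ * x' = 0) (hz : A * z + z' * B = 0)
    (hne : (xᵀ * z).trace + (x'ᵀ * z').trace ≠ 0) :
    ∃ v, A *ᵥ v = 0 ∧ v ᵥ* x ≠ 0 ∧ B *ᵥ (v ᵥ* x) = 0 := by
  classical
  by_contra! hcon
  -- The vector vᵀx is in ker B whenever Av = 0, since vᵀxBᵀ = -(Av)ᵀx'. The negated claim therefore
  -- says that it vanishes.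
  have hker : ∀ v, A *ᵥ v = 0 → v ᵥ* x = 0 := fun v hv => by
    by_contra h
    refine hcon v hv h ?_
    rw [← vecMul_transpose, vecMul_vecMul, eq_neg_of_add_eq_zero_left hx, vecMul_neg,
      ← vecMul_vecMul, vecMul_transpose, hv, zero_vecMul, neg_zero]
  -- Each column of x is orthogonal to ker A, hence in the row space of A.
  have hcol : ∀ j, ∃ y : m₁ → ZMod 2, y ᵥ* A = fun i => x i j := fun j => by
    by_contra! h
    have hn : (fun i => x i j) ∉ Submodule.span (ZMod 2) (Set.range A.row) := fun hm => by
      rw [← range_vecMulLinear] at hm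
      obtain ⟨y, hy⟩ := hm
      exact h y hy
    obtain ⟨v, hv, hv'⟩ := exists_dotProduct_ne_zero_of_notMem_span A hn
    exact hv' (by rw [dotProduct_comm]; exact congrFun (hker v hv) j)
  choose y hy using hcol
  obtain ⟨Y, rfl⟩ : ∃ Y, x = Aᵀ * Y := ⟨(Matrix.of y)ᵀ, by
    ext i j
    rw [← congrFun (hy j) i]
    simp [vecMul, dotProduct, mul_apply, mul_comm]⟩
  -- Independence of the rows of A cancels Aᵀ. Thus (x, x') = (AᵀY, YBᵀ) is a product of X-checks.
  have hx' : x' = Y * Bᵀ := by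
    have h : Aᵀ * (Y * Bᵀ + x') = 0 := by rw [Matrix.mul_add, ← Matrix.mul_assoc, hx]
    ext a b
    have hab : (fun a => (Y * Bᵀ + x') a b) = 0 := by
      refine vecMul_injective_iff.2 hA (Eq.trans ?_ (zero_vecMul A).symm)
      ext i
      have := congrFun (congrFun h i) b
      rw [mul_apply] at this
      simpa only [vecMul, dotProduct, transpose_apply, mul_comm, Matrix.zero_apply, Pi.zero_apply] using this
    rw [← ZMod.neg_eq_self_mod_two ((Y * Bᵀ) a b)]
    exact eq_neg_of_add_eq_zero_right (congrFun hab a)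
  -- The pairing equals the trace of Yᵀ(Az + z'B), which is zero.
  apply hne
  rw [hx', transpose_mul, transpose_mul, transpose_transpose, transpose_transpose,
    Matrix.mul_assoc, Matrix.mul_assoc, Matrix.trace_mul_comm B, ← Matrix.trace_add,
    Matrix.mul_assoc, ← Matrix.mul_add, hz, Matrix.mul_zero, Matrix.trace_zero]

/-- A vector that vanishes off the supports of the checks in `I` and is constant on each of these
disjoint supports is a combination of the checks in `I`. -/
theorem exists_eq_vecMul {m n : ℕ} (H : Matrix (Fin m) (Fin n) (ZMod 2)) (I : Fin m → Prop)
    (hI : ∀ c c' b, I c → I c' → H c b ≠ 0 → H c' b ≠ 0 → c = c')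
    (ord : ∀ c, Fin (Fintype.card (Supp H c)) ≃ Supp H c) (s : Fin n → ZMod 2)
    (h0 : ∀ b, (¬ ∃ c, I c ∧ H c b ≠ 0) → s b = 0)
    (h1 : ∀ c, I c → ∀ k : ℕ, ∀ hk : k + 1 < Fintype.card (Supp H c),
      s (ord c ⟨k, Nat.lt_of_succ_lt hk⟩).1 = s (ord c ⟨k + 1, hk⟩).1) :
    ∃ y : Fin m → ZMod 2, (∀ c, ¬ I c → y c = 0) ∧ y ᵥ* H = s := by
  classical
  have hconst : ∀ c, I c → ∀ b b', H c b ≠ 0 → H c b' ≠ 0 → s b = s b' := by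
    intro c hc
    have key : ∀ k, ∀ hk : k < Fintype.card (Supp H c),
        s (ord c ⟨k, hk⟩).1 = s (ord c ⟨0, by omega⟩).1 := by
      intro k
      induction k with
      | zero => intro _; rfl
      | succ k ih => intro hk; rw [← h1 c hc k hk, ih]
    have key' : ∀ b, ∀ hb : H c b ≠ 0,
        s b = s (ord c ⟨0, Fintype.card_pos_iff.2 ⟨⟨b, hb⟩⟩⟩).1 := fun b hb => by
      rw [← key ((ord c).symm ⟨b, hb⟩).1 ((ord c).symm ⟨b, hb⟩).2]
      simp
    intro b b' hb hb'
    rw [key' b hb, key' b' hb']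
  -- The coefficient of a check in `I` is the common value of s on its support; a check with empty
  -- support gets 0 and contributes nothing either way.
  refine ⟨fun c => if h : I c ∧ ∃ b, H c b ≠ 0 then s h.2.choose else 0, fun c hc => ?_, ?_⟩
  · simp [hc]
  · ext b
    by_cases hb : ∃ c, I c ∧ H c b ≠ 0
    · obtain ⟨c, hc, hcb⟩ := hb
      simp only [vecMul, dotProduct]
      rw [Finset.sum_eq_single c]
      · have h : I c ∧ ∃ b, H c b ≠ 0 := ⟨hc, b, hcb⟩
        rw [dif_pos h, eq_one_of_ne_zero hcb, mul_one]
        exact hconst c hc _ _ h.2.choose_spec hcb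
      · intro c' _ hne
        by_cases h : I c' ∧ H c' b ≠ 0
        · exact absurd (hI _ _ _ h.1 hc h.2 hcb) hne
        · by_cases h' : I c'
          · have : H c' b = 0 := by_contra fun h'' => h ⟨h', h''⟩
            rw [this, mul_zero]
          · simp [h']
      · simp
    · rw [h0 b hb]
      simp only [vecMul, dotProduct]
      refine Finset.sum_eq_zero fun c _ => ?_
      by_cases hc : I c
      · have : H c b = 0 := by_contra fun h => hb ⟨c, hc, h⟩
        simp [this]
      · simp [hc]

end HGPReduction

namespace HGPReduction

/-! ### Logical operators of the reduced code -/

variable {m₁ n₁ m₂ n₂ : ℕ}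

theorem hgpX_mulVec (H₁ : Matrix (Fin m₁) (Fin n₁) (ZMod 2))
    (H₂ : Matrix (Fin m₂) (Fin n₂) (ZMod 2)) (z : Fin n₁ × Fin n₂ ⊕ Fin m₁ × Fin m₂ → ZMod 2)
    (a : Fin m₁) (j : Fin n₂) :
    (hgpX H₁ H₂ *ᵥ z) (a, j) =
      ∑ i, H₁ a i * z (Sum.inl (i, j)) + ∑ b, z (Sum.inr (a, b)) * H₂ b j := by
  simp only [mulVec, dotProduct, Fintype.sum_sum_type, Fintype.sum_prod_type, hgpX,
    fromCols_apply_inl, fromCols_apply_inr, kroneckerMap_apply, transpose_apply, one_apply]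
  congr 1
  · simp
  · rw [Finset.sum_eq_single a] <;> simp +contextual [mul_comm, eq_comm]

theorem hgpZ_mulVec (H₁ : Matrix (Fin m₁) (Fin n₁) (ZMod 2))
    (H₂ : Matrix (Fin m₂) (Fin n₂) (ZMod 2)) (x : Fin n₁ × Fin n₂ ⊕ Fin m₁ × Fin m₂ → ZMod 2)
    (i : Fin n₁) (b : Fin m₂) :
    (hgpZ H₁ H₂ *ᵥ x) (i, b) =
      ∑ j, H₂ b j * x (Sum.inl (i, j)) + ∑ a, x (Sum.inr (a, b)) * H₁ a i := by
  simp only [mulVec, dotProduct, Fintype.sum_sum_type, Fintype.sum_prod_type, hgpZ,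
    fromCols_apply_inl, fromCols_apply_inr, kroneckerMap_apply, transpose_apply, one_apply]
  congr 1
  · rw [Finset.sum_eq_single i] <;> simp +contextual [eq_comm]
  · simp [mul_comm]

namespace Reduction

variable {H₁ : Matrix (Fin m₁) (Fin n₁) (ZMod 2)} {H₂ : Matrix (Fin m₂) (Fin n₂) (ZMod 2)}
variable (R : Reduction H₁ H₂)

/-! ### Restoring values on the removed qubits -/

theorem V_mulVec_map (z : R.Qubit → ZMod 2) (q : R.Qubit) :
    (R.V *ᵥ z) (Sum.map id Subtype.val q) = z q := by
  have hinj : Function.Injective (Sum.map id Subtype.val : R.Qubit → _) :=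
    Sum.map_injective.2 ⟨Function.injective_id, Subtype.val_injective⟩
  simp [V, mulVec, dotProduct, one_apply, hinj.eq_iff]

theorem V_mulVec_inr (z : R.Qubit → ZMod 2) {c : Fin m₁ × Fin m₂} (hc : R.InX c ∨ R.InZ c) :
    (R.V *ᵥ z) (Sum.inr c) = 0 := by
  refine Finset.sum_eq_zero fun q _ => ?_
  rcases q with p | q
  · simp [V, one_apply]
  · have : c ≠ q.1 := fun h => q.2 (h ▸ hc)
    simp [V, one_apply, this]

theorem WX_mulVec_inl (s : Fin m₁ × Fin n₂ → ZMod 2) (d : {d // ¬ R.MergedX d}) :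
    (R.WX *ᵥ s) (Sum.inl d) = s d.1 := by
  simp [WX, mulVec]

theorem WX_mulVec_inr (s : Fin m₁ × Fin n₂ → ZMod 2) (r : R.CombX) :
    (R.WX *ᵥ s) (Sum.inr r) =
      s (r.1.1.1, R.colOf r false) + s (r.1.1.1, R.colOf r true) := by
  simp only [WX, mulVec, of_apply]
  exact (add_dotProduct _ _ _).trans (by simp)

theorem WZ_mulVec_inl (s : Fin n₁ × Fin m₂ → ZMod 2) (d : {d // ¬ R.MergedZ d}) :
    (R.WZ *ᵥ s) (Sum.inl d) = s d.1 := by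
  simp [WZ, mulVec]

theorem WZ_mulVec_inr (s : Fin n₁ × Fin m₂ → ZMod 2) (r : R.CombZ) :
    (R.WZ *ᵥ s) (Sum.inr r) =
      s (R.rowOf r false, r.1.1.2) + s (R.rowOf r true, r.1.1.2) := by
  simp only [WZ, mulVec, of_apply]
  exact (add_dotProduct _ _ _).trans (by simp)

theorem HX_mulVec (z : R.Qubit → ZMod 2) :
    R.code.HX *ᵥ z = R.WX *ᵥ (hgpX H₁ H₂ *ᵥ (R.V *ᵥ z)) := by
  rw [mulVec_mulVec, mulVec_mulVec]
  rfl

theorem HZ_mulVec (x : R.Qubit → ZMod 2) :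
    R.code.HZ *ᵥ x = R.WZ *ᵥ (hgpZ H₁ H₂ *ᵥ (R.V *ᵥ x)) := by
  rw [mulVec_mulVec, mulVec_mulVec]
  rfl

theorem not_inZ_of_inX {c : Fin m₁ × Fin m₂} (h : R.InX c) : ¬ R.InZ c :=
  fun h' => Finset.disjoint_left.1 R.groups_disjoint h h'

/-- A vector in the kernel of the combined `X`-checks extends to a vector in the kernel of the
original ones, by values on the qubits at which `X`-checks are combined. -/
theorem exists_extension_X (z : R.Qubit → ZMod 2) (hz : R.code.HX *ᵥ z = 0) :
    ∃ z', hgpX H₁ H₂ *ᵥ z' = 0 ∧ (∀ q, z' (Sum.map id Subtype.val q) = z q) ∧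
      ∀ c, R.InZ c → z' (Sum.inr c) = 0 := by
  have hz' : R.WX *ᵥ (hgpX H₁ H₂ *ᵥ (R.V *ᵥ z)) = 0 := by
    rwa [← HX_mulVec]
  -- The syndrome of the zero-filled z is treated row by row: kept checks make it vanish away from
  -- the removed qubits, combined checks make it constant around each of them.
  have key : ∀ a, ∃ y : Fin m₂ → ZMod 2, (∀ b, ¬ R.InX (a, b) → y b = 0) ∧
      y ᵥ* H₂ = fun j => (hgpX H₁ H₂ *ᵥ (R.V *ᵥ z)) (a, j) := by
    intro a
    refine exists_eq_vecMul H₂ (fun b => R.InX (a, b)) ?_ (fun b => R.ordX (a, b)) _ ?_ ?_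
    · intro b b' j hb hb' h h'
      by_contra hne
      exact R.col₂.valid (v := b) (w := b') ⟨hne, j, h, h'⟩ (R.groupsX_row _ _ _ hb hb')
    · intro j hj
      have h := R.WX_mulVec_inl (hgpX H₁ H₂ *ᵥ (R.V *ᵥ z)) ⟨(a, j), hj⟩
      rw [hz'] at h
      exact h.symm
    · intro b hb k hk
      have h := R.WX_mulVec_inr (hgpX H₁ H₂ *ᵥ (R.V *ᵥ z)) ⟨⟨(a, b), hb⟩, ⟨k, Nat.lt_sub_of_add_lt hk⟩⟩
      rw [hz'] at h
      exact (CharTwo.add_eq_zero.1 h.symm)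
  choose y hy0 hy using key
  -- Adding y cancels the syndrome in characteristic 2 and changes only qubits of the X-groups.
  refine ⟨R.V *ᵥ z + Sum.elim (0 : Fin n₁ × Fin n₂ → ZMod 2) (fun c => y c.1 c.2), ?_, ?_, ?_⟩
  · ext ⟨a, j⟩
    rw [mulVec_add, Pi.add_apply, ← congrFun (hy a) j, hgpX_mulVec]
    simp only [Sum.elim_inl, Sum.elim_inr, Pi.zero_apply, mul_zero, Finset.sum_const_zero,
      zero_add]
    exact CharTwo.add_self_eq_zero _
  · rintro (p | c)
    · rw [Pi.add_apply, V_mulVec_map]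
      simp
    · have h := c.2
      have h' : ¬ R.InX (c.1.1, c.1.2) := fun h' => h (Or.inl h')
      rw [Pi.add_apply, V_mulVec_map, Sum.map_inr, Sum.elim_inr, hy0 _ _ h', add_zero]
  · intro c hc
    have h' : ¬ R.InX (c.1, c.2) := fun h' => R.not_inZ_of_inX h' hc
    rw [Pi.add_apply, R.V_mulVec_inr z (Or.inr hc), Sum.elim_inr, hy0 _ _ h', add_zero]

/-- A vector in the kernel of the combined `Z`-checks extends to a vector in the kernel of the
original ones, by values on the qubits at which `Z`-checks are combined. -/
theorem exists_extension_Z (x : R.Qubit → ZMod 2) (hx : R.code.HZ *ᵥ x = 0) :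
    ∃ x', hgpZ H₁ H₂ *ᵥ x' = 0 ∧ (∀ q, x' (Sum.map id Subtype.val q) = x q) ∧
      ∀ c, R.InX c → x' (Sum.inr c) = 0 := by
  have hx' : R.WZ *ᵥ (hgpZ H₁ H₂ *ᵥ (R.V *ᵥ x)) = 0 := by
    rwa [← HZ_mulVec]
  have key : ∀ b, ∃ y : Fin m₁ → ZMod 2, (∀ a, ¬ R.InZ (a, b) → y a = 0) ∧
      y ᵥ* H₁ = fun i => (hgpZ H₁ H₂ *ᵥ (R.V *ᵥ x)) (i, b) := by
    intro b
    refine exists_eq_vecMul H₁ (fun a => R.InZ (a, b)) ?_ (fun a => R.ordZ (a, b)) _ ?_ ?_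
    · intro a a' i ha ha' h h'
      by_contra hne
      exact R.col₁.valid (v := a) (w := a') ⟨hne, i, h, h'⟩ (R.groupsZ_col _ _ _ ha ha')
    · intro i hi
      have h := R.WZ_mulVec_inl (hgpZ H₁ H₂ *ᵥ (R.V *ᵥ x)) ⟨(i, b), hi⟩
      rw [hx'] at h
      exact h.symm
    · intro a ha k hk
      have h := R.WZ_mulVec_inr (hgpZ H₁ H₂ *ᵥ (R.V *ᵥ x)) ⟨⟨(a, b), ha⟩, ⟨k, Nat.lt_sub_of_add_lt hk⟩⟩
      rw [hx'] at h
      exact (CharTwo.add_eq_zero.1 h.symm)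
  choose y hy0 hy using key
  refine ⟨R.V *ᵥ x + Sum.elim (0 : Fin n₁ × Fin n₂ → ZMod 2) (fun c => y c.2 c.1), ?_, ?_, ?_⟩
  · ext ⟨i, b⟩
    rw [mulVec_add, Pi.add_apply, ← congrFun (hy b) i, hgpZ_mulVec]
    simp only [Sum.elim_inl, Sum.elim_inr, Pi.zero_apply, mul_zero, Finset.sum_const_zero,
      zero_add]
    exact CharTwo.add_self_eq_zero _
  · rintro (p | c)
    · rw [Pi.add_apply, V_mulVec_map]
      simp
    · have h := c.2
      have h' : ¬ R.InZ (c.1.1, c.1.2) := fun h' => h (Or.inr h')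
      rw [Pi.add_apply, V_mulVec_map, Sum.map_inr, Sum.elim_inr, hy0 _ _ h', add_zero]
  · intro c hc
    have h' : ¬ R.InZ (c.1, c.2) := R.not_inZ_of_inX hc
    rw [Pi.add_apply, R.V_mulVec_inr x (Or.inl hc), Sum.elim_inr, hy0 _ _ h', add_zero]

/-- Extensions by values on disjoint sets of qubits have the same pairing. -/
theorem sum_mul_extension (x z : R.Qubit → ZMod 2)
    (x' z' : Fin n₁ × Fin n₂ ⊕ Fin m₁ × Fin m₂ → ZMod 2)
    (hx : ∀ q, x' (Sum.map id Subtype.val q) = x q)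
    (hz : ∀ q, z' (Sum.map id Subtype.val q) = z q)
    (hx0 : ∀ c, R.InX c → x' (Sum.inr c) = 0) (hz0 : ∀ c, R.InZ c → z' (Sum.inr c) = 0) :
    x' ⬝ᵥ z' = x ⬝ᵥ z := by
  simp only [dotProduct, Fintype.sum_sum_type, ← hx, ← hz, Sum.map_inl, Sum.map_inr, id]
  congr 1
  rw [← Finset.sum_subtype (Finset.univ.filter fun c => ¬ (R.InX c ∨ R.InZ c)) (by simp)
    (fun c => x' (Sum.inr c) * z' (Sum.inr c))]
  symm
  -- On a removed qubit one factor is zero: x' on the X-groups, z' on the Z-groups.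
  refine Finset.sum_filter_of_ne fun c _ hne hc => hne ?_
  rcases hc with hc | hc
  · rw [hx0 c hc, zero_mul]
  · rw [hz0 c hc, mul_zero]

theorem dotProduct_eq_trace_add_trace (x z : Fin n₁ × Fin n₂ ⊕ Fin m₁ × Fin m₂ → ZMod 2) :
    x ⬝ᵥ z =
      ((Matrix.of fun i j => x (Sum.inl (i, j)))ᵀ * Matrix.of fun i j => z (Sum.inl (i, j))).trace +
      ((Matrix.of fun a b => x (Sum.inr (a, b)))ᵀ * Matrix.of fun a b => z (Sum.inr (a, b))).trace
    := by
  simp only [dotProduct, Fintype.sum_sum_type, Fintype.sum_prod_type, Matrix.trace, diag_apply,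
    mul_apply, transpose_apply, of_apply]
  congr 1 <;> exact Finset.sum_comm

/-- A nontrivial `X`-type logical operator restricts, along the rows weighted by a codeword of the
first classical code, to a nonzero codeword of the second one. -/
theorem exists_codeword_X (hH₁ : LinearIndependent (ZMod 2) H₁.row) (x : R.Qubit → ZMod 2)
    (hx : R.code.HZ *ᵥ x = 0)
    (hx' : x ∉ Submodule.span (ZMod 2) (Set.range R.code.HX.row)) :
    ∃ v w, H₁ *ᵥ v = 0 ∧ H₂ *ᵥ w = 0 ∧ w ≠ 0 ∧ w = fun j => ∑ i, v i * x (Sum.inl (i, j)) := by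
  obtain ⟨z, hz, hxz⟩ := exists_dotProduct_ne_zero_of_notMem_span _ hx'
  obtain ⟨x', hx1, hx2, hx3⟩ := R.exists_extension_Z x hx
  obtain ⟨z', hz1, hz2, hz3⟩ := R.exists_extension_X z hz
  rw [← R.sum_mul_extension x z x' z' hx2 hz2 hx3 hz3, dotProduct_eq_trace_add_trace] at hxz
  obtain ⟨v, hv1, hv2, hv3⟩ := exists_ker_vecMul_ne_zero H₁ H₂ hH₁ _ _ _ _ (by
    ext i b
    simpa [hgpZ_mulVec, mul_apply, mul_comm] using congrFun hx1 (i, b)) (by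
    ext a j
    simpa [hgpX_mulVec, mul_apply, mul_comm] using congrFun hz1 (a, j)) hxz
  refine ⟨v, _, hv1, hv3, hv2, ?_⟩
  ext j
  -- The restored values sit on check-type qubits, so the codeword is read off x itself.
  simp only [vecMul, dotProduct, of_apply, ← hx2]
  rfl

/-- A nontrivial `Z`-type logical operator restricts, along the columns weighted by a codeword of
the second classical code, to a nonzero codeword of the first one. -/
theorem exists_codeword_Z (hH₂ : LinearIndependent (ZMod 2) H₂.row) (z : R.Qubit → ZMod 2)
    (hz : R.code.HX *ᵥ z = 0)
    (hz' : z ∉ Submodule.span (ZMod 2) (Set.range R.code.HZ.row)) :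
    ∃ v w, H₂ *ᵥ v = 0 ∧ H₁ *ᵥ w = 0 ∧ w ≠ 0 ∧ w = fun i => ∑ j, v j * z (Sum.inl (i, j)) := by
  obtain ⟨x, hx, hxz⟩ := exists_dotProduct_ne_zero_of_notMem_span _ hz'
  obtain ⟨x', hx1, hx2, hx3⟩ := R.exists_extension_Z x hx
  obtain ⟨z', hz1, hz2, hz3⟩ := R.exists_extension_X z hz
  rw [dotProduct_comm, ← R.sum_mul_extension x z x' z' hx2 hz2 hx3 hz3, dotProduct_comm,
    dotProduct_eq_trace_add_trace] at hxz
  -- Transposing all four matrices exchanges the two classical codes.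
  obtain ⟨v, hv1, hv2, hv3⟩ := exists_ker_vecMul_ne_zero H₂ H₁ hH₂
    (Matrix.of fun i j => z' (Sum.inl (i, j)))ᵀ (Matrix.of fun i j => x' (Sum.inl (i, j)))ᵀ
    (Matrix.of fun a b => z' (Sum.inr (a, b)))ᵀ (Matrix.of fun a b => x' (Sum.inr (a, b)))ᵀ (by
    ext j a
    simpa [hgpX_mulVec, mul_apply, mul_comm] using congrFun hz1 (a, j)) (by
    ext b i
    simpa [hgpZ_mulVec, mul_apply, mul_comm] using congrFun hx1 (i, b)) (by
    rwa [Matrix.trace_transpose_mul, Matrix.trace_transpose_mul])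
  refine ⟨v, _, hv1, hv3, hv2, ?_⟩
  ext i
  simp only [vecMul, dotProduct, transpose_apply, of_apply, ← hz2]
  rfl

/-! ### Product logical operators on the bit-type qubits -/

theorem V_mulVec_elim (f : Fin n₁ × Fin n₂ → ZMod 2) :
    R.V *ᵥ Sum.elim f 0 = Sum.elim f 0 := by
  ext (p | c)
  · exact R.V_mulVec_map _ (Sum.inl p)
  · by_cases hc : R.InX c ∨ R.InZ c
    · exact R.V_mulVec_inr _ hc
    · exact R.V_mulVec_map _ (Sum.inr ⟨c, hc⟩)

/-- In each column an original X-check acts on the bit-type qubits as a check of `H₁` or not at all,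
so u may be arbitrary. Taking u a unit vector yields both short logical operators and the
functionals that detect them. -/
theorem HX_mulVec_eq_zero (v : Fin n₁ → ZMod 2) (u : Fin n₂ → ZMod 2) (hv : H₁ *ᵥ v = 0) :
    R.code.HX *ᵥ Sum.elim (fun p => v p.1 * u p.2) 0 = 0 := by
  have h : hgpX H₁ H₂ *ᵥ (R.V *ᵥ Sum.elim (fun p => v p.1 * u p.2) 0) = 0 := by
    rw [V_mulVec_elim]
    ext ⟨a, j⟩
    have ha : ∑ i, H₁ a i * v i = 0 := congrFun hv a
    simp [hgpX_mulVec, ← mul_assoc, ← Finset.sum_mul, ha]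
  rw [HX_mulVec, h, mulVec_zero]

theorem HZ_mulVec_eq_zero (u : Fin n₁ → ZMod 2) (w : Fin n₂ → ZMod 2) (hw : H₂ *ᵥ w = 0) :
    R.code.HZ *ᵥ Sum.elim (fun p => u p.1 * w p.2) 0 = 0 := by
  have h : hgpZ H₁ H₂ *ᵥ (R.V *ᵥ Sum.elim (fun p => u p.1 * w p.2) 0) = 0 := by
    rw [V_mulVec_elim]
    ext ⟨i, b⟩
    have hb : ∑ j, H₂ b j * w j = 0 := congrFun hw b
    simp [hgpZ_mulVec, mul_left_comm _ (u i), ← Finset.mul_sum, hb]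
  rw [HZ_mulVec, h, mulVec_zero]

/-- The X-operator e_i ⊗ w with v i ≠ 0 commutes with all checks. It is no stabilizer, since it
pairs with v ⊗ e_j to v i * w j ≠ 0, where w j ≠ 0. -/
theorem distance_le_card_right {v : Fin n₁ → ZMod 2} {w : Fin n₂ → ZMod 2} (hv : H₁ *ᵥ v = 0)
    (hw : H₂ *ᵥ w = 0) (hv0 : v ≠ 0) (hw0 : w ≠ 0) :
    R.code.distance ≤ (Finset.univ.filter fun j => w j ≠ 0).card := by
  obtain ⟨i, hi⟩ := Function.ne_iff.1 hv0
  obtain ⟨j, hj⟩ := Function.ne_iff.1 hw0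
  refine iInf₂_le_of_le (Sum.elim (fun p => (Pi.single i 1 : Fin n₁ → ZMod 2) p.1 * w p.2) 0, 0)
    ⟨R.HZ_mulVec_eq_zero _ w hw, mulVec_zero _, fun h => ?_⟩ ?_
  · have h0 := dotProduct_eq_zero_of_mem_span _ h.1
      (R.HX_mulVec_eq_zero v (Pi.single j 1) hv)
    simp [dotProduct, Fintype.sum_prod_type, Pi.single_apply] at h0
    simp_all
  · rw [Nat.cast_le]
    refine Finset.card_le_card_of_surjOn (fun j => Sum.inl (i, j)) ?_
    rintro (⟨i', j'⟩ | c) hq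
    · by_cases h : i' = i
      · subst h
        exact ⟨j', by simpa using hq, rfl⟩
      · simp [h] at hq
    · simp at hq

theorem distance_le_card_left {v : Fin n₁ → ZMod 2} {w : Fin n₂ → ZMod 2} (hv : H₁ *ᵥ v = 0)
    (hw : H₂ *ᵥ w = 0) (hv0 : v ≠ 0) (hw0 : w ≠ 0) :
    R.code.distance ≤ (Finset.univ.filter fun i => v i ≠ 0).card := by
  obtain ⟨i, hi⟩ := Function.ne_iff.1 hv0
  obtain ⟨j, hj⟩ := Function.ne_iff.1 hw0
  refine iInf₂_le_of_le (0, Sum.elim (fun p => v p.1 * (Pi.single j 1 : Fin n₂ → ZMod 2) p.2) 0)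
    ⟨mulVec_zero _, R.HX_mulVec_eq_zero v _ hv, fun h => ?_⟩ ?_
  · have h0 := dotProduct_eq_zero_of_mem_span _ h.2
      (R.HZ_mulVec_eq_zero (Pi.single i 1) w hw)
    simp [dotProduct, Fintype.sum_prod_type, Pi.single_apply] at h0
    simp_all
  · rw [Nat.cast_le]
    refine Finset.card_le_card_of_surjOn (fun i => Sum.inl (i, j)) ?_
    rintro (⟨i', j'⟩ | c) hq
    · by_cases h : j' = j
      · subst h
        exact ⟨i', by simpa using hq, rfl⟩
      · simp [h] at hq
    · simp at hq

/-- The bit-type part of an `X`-check is a combination of classical checks in each column. -/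
theorem sum_mul_HX (v : Fin n₁ → ZMod 2) (hv : H₁ *ᵥ v = 0) (c : R.CheckX) (j : Fin n₂) :
    ∑ i, v i * R.code.HX c (Sum.inl (i, j)) = 0 := by
  have h := congrFun (R.HX_mulVec_eq_zero v (Pi.single j 1) hv) c
  simpa [mulVec, dotProduct, Fintype.sum_prod_type, Pi.single_apply, mul_comm] using h

theorem sum_mul_HZ (w : Fin n₂ → ZMod 2) (hw : H₂ *ᵥ w = 0) (c : R.CheckZ) (i : Fin n₁) :
    ∑ j, w j * R.code.HZ c (Sum.inl (i, j)) = 0 := by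
  have h := congrFun (R.HZ_mulVec_eq_zero (Pi.single i 1) w hw) c
  simpa [mulVec, dotProduct, Fintype.sum_prod_type, Pi.single_apply, mul_comm] using h

end Reduction

end HGPReduction

namespace HGPReduction

/-! ### Propagation through circuits of CNOT gates -/

section Flow

variable {ι : Type*} [DecidableEq ι]

/-- The parity of the number of time steps at which the gate `(k, i)` is applied. -/
def flow (U : Circuit ι) (k i : ι) : ZMod 2 :=
  (U.map fun L => if (k, i) ∈ L then 1 else 0).sum

theorem flow_cons (L : Finset (ι × ι)) (U : Circuit ι) (k i : ι) :
    flow (L :: U) k i = (if (k, i) ∈ L then 1 else 0) + flow U k i := by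
  simp [flow]

theorem flow_append (U U' : Circuit ι) (k i : ι) :
    flow (U ++ U') k i = flow U k i + flow U' k i := by
  simp [flow]

theorem flow_eq_zero {U : Circuit ι} {k i : ι} (h : ∀ L ∈ U, (k, i) ∉ L) : flow U k i = 0 := by
  refine List.sum_eq_zero fun a ha => ?_
  obtain ⟨L, hL, rfl⟩ := List.mem_map.1 ha
  exact if_neg (h L hL)

theorem flow_take_add_flow_drop (U : Circuit ι) (t : ℕ) (k i : ι) :
    flow (U.take t) k i + flow (U.drop t) k i = flow U k i := by
  rw [← flow_append, List.take_append_drop]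

theorem propagate_cons (L : Finset (ι × ι)) (U : Circuit ι) (P : Pauli ι) :
    propagate (L :: U) P = propagate U (propagateStep L P) := rfl

theorem propagate_append (U U' : Circuit ι) (P : Pauli ι) :
    propagate (U ++ U') P = propagate U' (propagate U P) := by
  simp [propagate]

theorem propagateStep_zero (L : Finset (ι × ι)) : propagateStep L (0 : Pauli ι) = 0 := by
  simp only [propagateStep]
  ext <;> simp

theorem propagate_zero (U : Circuit ι) : propagate U (0 : Pauli ι) = 0 := by
  induction U with
  | nil => rfl
  | cons L U ih => rw [propagate_cons, propagateStep_zero, ih]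

variable [Fintype ι]

theorem propagateStep_fst (L : Finset (ι × ι)) (P : Pauli ι) (i : ι) :
    (propagateStep L P).1 i = P.1 i + ∑ k, P.1 k * if (k, i) ∈ L then 1 else 0 := by
  simp only [propagateStep, mul_ite, mul_one, mul_zero, ← Finset.sum_filter]
  congr 1
  refine Finset.sum_bij' (fun g _ => g.1) (fun k _ => (k, i)) ?_ ?_ ?_ ?_ ?_ <;>
    aesop

theorem propagateStep_snd (L : Finset (ι × ι)) (P : Pauli ι) (i : ι) :
    (propagateStep L P).2 i = P.2 i + ∑ k, P.2 k * if (i, k) ∈ L then 1 else 0 := by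
  simp only [propagateStep, mul_ite, mul_one, mul_zero, ← Finset.sum_filter]
  congr 1
  refine Finset.sum_bij' (fun g _ => g.2) (fun k _ => (i, k)) ?_ ?_ ?_ ?_ ?_ <;>
    aesop

/-- If no control of a gate with target `i` is ever a target, then the `X`-errors arriving at `i`
are counted by the gates with target `i`. -/
theorem propagate_fst (U : Circuit ι) (i : ι)
    (h : ∀ L ∈ U, ∀ k, (k, i) ∈ L → ∀ L' ∈ U, ∀ k', (k', k) ∉ L') (P : Pauli ι) :
    (propagate U P).1 i = P.1 i + ∑ k, P.1 k * flow U k i := by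
  induction U generalizing P with
  | nil => simp [propagate, flow]
  | cons L U ih =>
    rw [propagate_cons, ih (fun L hL k hk L' hL' => h L (List.mem_cons_of_mem _ hL) k hk L'
      (List.mem_cons_of_mem _ hL')), propagateStep_fst, add_assoc, ← Finset.sum_add_distrib]
    congr 1
    refine Finset.sum_congr rfl fun k _ => ?_
    rw [flow_cons, mul_add]
    congr 1
    -- A control k of a later gate on i is not a target in `L`, so its X-error is unchanged by this
    -- step; for any other k the later flow is zero.
    by_cases hk : ∃ L' ∈ U, (k, i) ∈ L'
    · obtain ⟨L', hL', hk⟩ := hk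
      rw [propagateStep_fst, Finset.sum_eq_zero fun k' _ => ?_, add_zero]
      rw [if_neg (h L' (List.mem_cons_of_mem _ hL') k hk L List.mem_cons_self k'), mul_zero]
    · push Not at hk
      rw [flow_eq_zero hk, mul_zero, mul_zero]

/-- If no target of a gate with control `i` is ever a control, then the `Z`-errors arriving at `i`
are counted by the gates with control `i`. -/
theorem propagate_snd (U : Circuit ι) (i : ι)
    (h : ∀ L ∈ U, ∀ k, (i, k) ∈ L → ∀ L' ∈ U, ∀ k', (k, k') ∉ L') (P : Pauli ι) :
    (propagate U P).2 i = P.2 i + ∑ k, P.2 k * flow U i k := by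
  induction U generalizing P with
  | nil => simp [propagate, flow]
  | cons L U ih =>
    rw [propagate_cons, ih (fun L hL k hk L' hL' => h L (List.mem_cons_of_mem _ hL) k hk L'
      (List.mem_cons_of_mem _ hL')), propagateStep_snd, add_assoc, ← Finset.sum_add_distrib]
    congr 1
    refine Finset.sum_congr rfl fun k _ => ?_
    rw [flow_cons, mul_add]
    congr 1
    by_cases hk : ∃ L' ∈ U, (i, k) ∈ L'
    · obtain ⟨L', hL', hk⟩ := hk
      rw [propagateStep_snd, Finset.sum_eq_zero fun k' _ => ?_, add_zero]
      rw [if_neg (h L' (List.mem_cons_of_mem _ hL') k hk L List.mem_cons_self k'), mul_zero]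
    · push Not at hk
      rw [flow_eq_zero hk, mul_zero, mul_zero]

theorem propagate_fst_of_forall_notMem {U : Circuit ι} {i : ι} (h : ∀ L ∈ U, ∀ k, (k, i) ∉ L)
    (P : Pauli ι) : (propagate U P).1 i = P.1 i := by
  rw [propagate_fst U i fun L hL k hk => absurd hk (h L hL k), Finset.sum_eq_zero, add_zero]
  exact fun k _ => by rw [flow_eq_zero fun L hL => h L hL k, mul_zero]

theorem propagate_snd_of_forall_notMem {U : Circuit ι} {i : ι} (h : ∀ L ∈ U, ∀ k, (i, k) ∉ L)
    (P : Pauli ι) : (propagate U P).2 i = P.2 i := by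
  rw [propagate_snd U i fun L hL k hk => absurd hk (h L hL k), Finset.sum_eq_zero, add_zero]
  exact fun k _ => by rw [flow_eq_zero fun L hL => h L hL k, mul_zero]

end Flow

/-! ### Circuits of staged edge colorings -/

/-- Giving each edge its own colour suffices; this makes the minimum number of colours well defined.
-/
theorem exists_isEdgeColoring {C Q : Type*} (E : Finset (C × Q)) :
    ∃ k f, IsEdgeColoring E k f := by
  classical
  refine ⟨E.card, fun e => if h : e ∈ E then (E.equivFin ⟨e, h⟩).1 else 0, fun e he => ?_,
    fun e he e' he' hne _ h => hne ?_⟩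
  · simp [he]
  · simp only [he, he', dif_pos] at h
    simpa using E.equivFin.injective (Fin.ext h)

theorem StageColoring.exists_isMinimum {C Q : Type*} [Fintype C] [Fintype Q]
    (H : Matrix C Q (ZMod 2)) (stage : C → Q → Fin 3) :
    ∃ S : StageColoring H stage, S.IsMinimum := by
  classical
  have h := fun α => exists_isEdgeColoring (stageEdges H stage α)
  exact ⟨⟨fun α => Nat.find (h α), fun α => (Nat.find_spec (h α)).choose,
    fun α => (Nat.find_spec (h α)).choose_spec⟩, fun α k f hf => Nat.find_min' (h α) ⟨f, hf⟩⟩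

namespace StageColoring

variable {C Q ι : Type*} [Fintype C] [Fintype Q] [DecidableEq ι]
  {H : Matrix C Q (ZMod 2)} {stage : C → Q → Fin 3} (S : StageColoring H stage)
  (gate : C × Q → ι × ι)

/-- The part of the circuit in the stage `α`. -/
def stageCircuit (α : Fin 3) : Circuit ι :=
  (List.range (S.num α)).map fun ξ =>
    ((stageEdges H stage α).filter fun e => S.color α e = ξ).image gate

theorem circuit_eq : S.circuit gate =
    S.stageCircuit gate 0 ++ (S.stageCircuit gate 1 ++ S.stageCircuit gate 2) := by
  simp [circuit, stageCircuit, List.finRange_succ]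

theorem exists_of_mem_stageCircuit {α : Fin 3} {L : Finset (ι × ι)}
    (hL : L ∈ S.stageCircuit gate α) {g : ι × ι} (hg : g ∈ L) :
    ∃ e, H e.1 e.2 ≠ 0 ∧ stage e.1 e.2 = α ∧ gate e = g := by
  obtain ⟨ξ, _, rfl⟩ := List.mem_map.1 hL
  obtain ⟨e, he, rfl⟩ := Finset.mem_image.1 hg
  simp only [stageEdges, Finset.mem_filter, Finset.mem_univ, true_and] at he
  exact ⟨e, he.1.1, he.1.2, rfl⟩

theorem exists_of_mem_circuit {L : Finset (ι × ι)} (hL : L ∈ S.circuit gate) {g : ι × ι}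
    (hg : g ∈ L) : ∃ e, H e.1 e.2 ≠ 0 ∧ gate e = g := by
  rw [circuit_eq, List.mem_append, List.mem_append] at hL
  rcases hL with hL | hL | hL <;>
    obtain ⟨e, he, -, h⟩ := S.exists_of_mem_stageCircuit gate hL hg <;> exact ⟨e, he, h⟩

/-- An edge of the stage occurs only in the layer of its own colour, and injectivity of `gate`
prevents other edges from producing the same gate. -/
theorem flow_stageCircuit (hgate : Function.Injective gate) (α : Fin 3) (e : C × Q) :
    flow (S.stageCircuit gate α) (gate e).1 (gate e).2 =
      if stage e.1 e.2 = α then H e.1 e.2 else 0 := by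
  by_cases he : e ∈ stageEdges H stage α
  · have he' : H e.1 e.2 ≠ 0 ∧ stage e.1 e.2 = α := by simpa [stageEdges] using he
    rw [if_pos he'.2, eq_one_of_ne_zero he'.1, flow, stageCircuit, List.map_map,
      ← List.sum_toFinset _ List.nodup_range, Finset.sum_eq_single (S.color α e)]
    · rw [Function.comp_apply, if_pos]
      exact Finset.mem_image_of_mem _ (Finset.mem_filter.2 ⟨he, rfl⟩)
    · intro ξ _ hξ
      rw [Function.comp_apply, if_neg]
      intro h
      obtain ⟨e', he', h⟩ := Finset.mem_image.1 h
      rw [hgate (h : gate e' = gate e)] at he'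
      exact hξ (Finset.mem_filter.1 he').2.symm
    · intro h
      simp [(S.proper α).1 e he] at h
  · rw [flow_eq_zero]
    · simp only [stageEdges, Finset.mem_filter, Finset.mem_univ, true_and, not_and, ne_eq] at he
      split_ifs with h
      · by_contra h'
        exact he (fun h'' => h' h''.symm) h
      · rfl
    · intro L hL hg
      obtain ⟨e', he', hs, h⟩ := S.exists_of_mem_stageCircuit gate hL hg
      rw [hgate (h : gate e' = gate e)] at he' hs
      exact he (by simp [stageEdges, he', hs])

theorem flow_circuit (hgate : Function.Injective gate) (e : C × Q) :
    flow (S.circuit gate) (gate e).1 (gate e).2 = H e.1 e.2 := by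
  simp only [circuit_eq, flow_append, S.flow_stageCircuit gate hgate]
  generalize stage e.1 e.2 = s
  fin_cases s <;> simp

/-- The gates of a syndrome qubit that remain after some time, or those that are over, belong all
to the first stage or all to the other ones. -/
theorem flow_drop_circuit (hgate : Function.Injective gate) (t : ℕ) :
    (∀ e : C × Q, flow ((S.circuit gate).drop t) (gate e).1 (gate e).2 ≠ 0 →
      H e.1 e.2 ≠ 0 ∧ stage e.1 e.2 ≠ 0) ∨
    (∀ e : C × Q, flow ((S.circuit gate).drop t) (gate e).1 (gate e).2 ≠ H e.1 e.2 →
      H e.1 e.2 ≠ 0 ∧ stage e.1 e.2 = 0) := by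
  have hex : ∀ {U : Circuit ι} {e : C × Q}, flow U (gate e).1 (gate e).2 ≠ 0 →
      ∃ L ∈ U, gate e ∈ L := fun h => by
    by_contra! h'
    exact h (flow_eq_zero h')
  -- Either stage 0 is over and only later gates remain, or only stage 0 gates have been applied.
  rcases le_total (S.stageCircuit gate 0).length t with ht | ht
  · left
    intro e he
    obtain ⟨L, hL, hg⟩ := hex he
    rw [circuit_eq, List.drop_append, List.drop_of_length_le ht, List.nil_append] at hL
    have hL' := List.mem_of_mem_drop hL
    rw [List.mem_append] at hL'
    rcases hL' with hL' | hL' <;>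
    · obtain ⟨e', he', hs, h⟩ := S.exists_of_mem_stageCircuit gate hL' hg
      obtain rfl := hgate h
      exact ⟨he', by simp [hs]⟩
  · right
    -- Where the remaining flow differs from the check, the gate has already been applied.
    intro e he
    obtain ⟨L, hL, hg⟩ := hex (U := (S.circuit gate).take t) (e := e) fun h => he (by
      rw [← S.flow_circuit gate hgate e, ← flow_take_add_flow_drop (S.circuit gate) t, h, zero_add])
    rw [circuit_eq, List.take_append_of_le_length ht] at hL
    obtain ⟨e', he', hs, h⟩ := S.exists_of_mem_stageCircuit gate (List.mem_of_mem_take hL) hg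
    obtain rfl := hgate h
    exact ⟨he', hs⟩

theorem wellFormed_circuit (hne : ∀ e e', (gate e).1 ≠ (gate e').2)
    (h₁ : ∀ e e', (gate e).1 = (gate e').1 → e.1 = e'.1 ∨ e.2 = e'.2)
    (h₂ : ∀ e e', (gate e).2 = (gate e').2 → e.1 = e'.1 ∨ e.2 = e'.2) :
    (S.circuit gate).WellFormed := by
  have key : ∀ α, (S.stageCircuit gate α).WellFormed := by
    intro α L hL
    obtain ⟨ξ, _, rfl⟩ := List.mem_map.1 hL
    have hp := (S.proper α).2
    simp only [Finset.forall_mem_image, Finset.mem_filter]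
    refine ⟨fun e _ => hne e e, fun e he e' he' hee' => ?_⟩
    have hcol : ¬ (e.1 = e'.1 ∨ e.2 = e'.2) := fun h =>
      hp e he.1 e' he'.1 (fun h' => hee' (h' ▸ rfl)) h (he.2.trans he'.2.symm)
    exact ⟨fun h => hcol (h₁ _ _ h), hne e e', (hne e' e).symm, fun h => hcol (h₂ _ _ h)⟩
  intro L hL
  rw [circuit_eq, List.mem_append, List.mem_append] at hL
  rcases hL with hL | hL | hL
  exacts [key _ L hL, key _ L hL, key _ L hL]

end StageColoring

/-! ### Counting faults -/

/-- Each fault location is charged to at most one index by `pos`, and every nonzero entry of w is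
charged at least once. -/
theorem card_support_le_faultCount {ι : Type*} [Fintype ι] {T n : ℕ}
    (F : Fin (T + 1) → Pauli ι) (w : Fin n → ZMod 2) (pos : Fin (T + 1) → ι → Option (Fin n))
    (h : ∀ j, w j ≠ 0 → ∃ t i, ((F t).1 i ≠ 0 ∨ (F t).2 i ≠ 0) ∧ pos t i = some j) :
    (Finset.univ.filter fun j => w j ≠ 0).card ≤ faultCount F := by
  classical
  rw [faultCount]
  simp only [weight]
  rw [← Finset.card_sigma]
  have hsub : (Finset.univ.filter fun j => w j ≠ 0).image some ⊆
      ((Finset.univ : Finset (Fin (T + 1))).sigma fun t =>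
        Finset.univ.filter fun i => (F t).1 i ≠ 0 ∨ (F t).2 i ≠ 0).image
        fun p => pos p.1 p.2 := by
    intro o ho
    obtain ⟨j, hj, rfl⟩ := Finset.mem_image.1 ho
    obtain ⟨t, i, hti, hp⟩ := h j (Finset.mem_filter.1 hj).2
    exact Finset.mem_image.2 ⟨⟨t, i⟩, by simpa using hti, hp⟩
  rw [← Finset.card_image_of_injective _ (Option.some_injective (Fin n))]
  exact (Finset.card_le_card hsub).trans Finset.card_image_le

/-- A logical operator inserted after the last time step is not propagated. -/
theorem CSSCode.effectiveDistance_le_distance {Q CX CZ : Type*} [Fintype Q] [Fintype CX]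
    [Fintype CZ] [DecidableEq Q] [DecidableEq CX] [DecidableEq CZ] (C : CSSCode Q CX CZ)
    (U : Circuit (Wire Q CX CZ)) : C.effectiveDistance U ≤ C.distance := by
  refine le_iInf₂ fun P hP => ?_
  set P' : Pauli (Wire Q CX CZ) := (Sum.elim P.1 0, Sum.elim P.2 0) with hP'
  have hF : finalError U (Pi.single (Fin.last _) P') = P' := by
    rw [finalError, Finset.sum_eq_single (Fin.last _)]
    · simp [propagate]
    · intro t _ ht
      rw [Pi.single_eq_of_ne ht, propagate_zero]
    · simp
  refine iInf₂_le_of_le (Pi.single (Fin.last _) P') (by rw [hF]; exact hP) ?_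
  rw [Nat.cast_le, faultCount, Finset.sum_eq_single (Fin.last _)]
  · rw [Pi.single_eq_same]
    refine Finset.card_le_card_of_surjOn Sum.inl ?_
    rintro (q | a) hq
    · exact ⟨q, by simpa [hP'] using hq, rfl⟩
    · simp [hP'] at hq
  · intro t _ ht
    simp [Pi.single_eq_of_ne ht, weight]
  · simp

end HGPReduction

namespace HGPReduction

/-! ### Circuits for `X`-checks and for `Z`-checks -/

section Wires

variable {Q CX CZ : Type*}

/-- All gates go from syndrome qubits of `X`-checks to data qubits. -/
def IsXCircuit (U : Circuit (Wire Q CX CZ)) : Prop :=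
  ∀ L ∈ U, ∀ g ∈ L, ∃ c q, g = (Sum.inr (Sum.inl c), Sum.inl q)

/-- All gates go from data qubits to syndrome qubits of `Z`-checks. -/
def IsZCircuit (U : Circuit (Wire Q CX CZ)) : Prop :=
  ∀ L ∈ U, ∀ g ∈ L, ∃ c q, g = (Sum.inl q, Sum.inr (Sum.inr c))

theorem IsXCircuit.drop {S : Circuit (Wire Q CX CZ)} (hS : IsXCircuit S) (t : ℕ) :
    IsXCircuit (S.drop t) := fun L hL => hS L (List.mem_of_mem_drop hL)

theorem IsZCircuit.drop {T : Circuit (Wire Q CX CZ)} (hT : IsZCircuit T) (t : ℕ) :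
    IsZCircuit (T.drop t) := fun L hL => hT L (List.mem_of_mem_drop hL)

/-- What remains at any time is a tail of each circuit. The truncated subtraction gives 0, hence the
whole second circuit, while the first one is running. -/
theorem exists_drop_mem {ι : Type*} {S T U : Circuit ι} (hU : U ∈ [S ++ T, T ++ S]) (t : ℕ) :
    ∃ s s', U.drop t ∈ [S.drop s ++ T.drop s', T.drop s' ++ S.drop s] := by
  simp only [List.mem_cons, List.not_mem_nil, or_false] at hU ⊢
  rcases hU with rfl | rfl
  · exact ⟨t, t - S.length, Or.inl List.drop_append⟩
  · exact ⟨t - T.length, t, Or.inr List.drop_append⟩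

variable [Fintype Q] [Fintype CX] [Fintype CZ] [DecidableEq Q] [DecidableEq CX] [DecidableEq CZ]
variable {S T U : Circuit (Wire Q CX CZ)}

theorem IsXCircuit.propagate_fst_inr (hS : IsXCircuit S) (P : Pauli (Wire Q CX CZ)) (a : CX ⊕ CZ) :
    (propagate S P).1 (Sum.inr a) = P.1 (Sum.inr a) :=
  propagate_fst_of_forall_notMem (fun L hL k hk => by
    obtain ⟨c, q, h⟩ := hS L hL _ hk
    simp at h) P

theorem IsXCircuit.propagate_snd_inl (hS : IsXCircuit S) (P : Pauli (Wire Q CX CZ)) (q : Q) :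
    (propagate S P).2 (Sum.inl q) = P.2 (Sum.inl q) :=
  propagate_snd_of_forall_notMem (fun L hL k hk => by
    obtain ⟨c, q, h⟩ := hS L hL _ hk
    simp at h) P

theorem IsXCircuit.propagate_snd_inr_inr (hS : IsXCircuit S) (P : Pauli (Wire Q CX CZ)) (d : CZ) :
    (propagate S P).2 (Sum.inr (Sum.inr d)) = P.2 (Sum.inr (Sum.inr d)) :=
  propagate_snd_of_forall_notMem (fun L hL k hk => by
    obtain ⟨c, q, h⟩ := hS L hL _ hk
    simp at h) P

theorem IsXCircuit.propagate_fst_inl (hS : IsXCircuit S) (P : Pauli (Wire Q CX CZ)) (q : Q) :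
    (propagate S P).1 (Sum.inl q) = P.1 (Sum.inl q) +
      ∑ c, P.1 (Sum.inr (Sum.inl c)) * flow S (Sum.inr (Sum.inl c)) (Sum.inl q) := by
  have h0 : ∀ k : Wire Q CX CZ, (∀ c, k ≠ Sum.inr (Sum.inl c)) → flow S k (Sum.inl q) = 0 :=
    fun k hk => flow_eq_zero fun L hL hg => by
      obtain ⟨c, q, h⟩ := hS L hL _ hg
      exact hk c (Prod.ext_iff.1 h).1
  rw [propagate_fst]
  · simp [Fintype.sum_sum_type, h0]
  · intro L hL k hk L' hL' k' hk'
    obtain ⟨c, q, h⟩ := hS L hL _ hk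
    obtain ⟨c', q', h'⟩ := hS L' hL' _ hk'
    simp_all

theorem IsXCircuit.propagate_snd_inr_inl (hS : IsXCircuit S) (P : Pauli (Wire Q CX CZ)) (c : CX) :
    (propagate S P).2 (Sum.inr (Sum.inl c)) = P.2 (Sum.inr (Sum.inl c)) +
      ∑ q, P.2 (Sum.inl q) * flow S (Sum.inr (Sum.inl c)) (Sum.inl q) := by
  have h0 : ∀ k : Wire Q CX CZ, (∀ q, k ≠ Sum.inl q) → flow S (Sum.inr (Sum.inl c)) k = 0 :=
    fun k hk => flow_eq_zero fun L hL hg => by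
      obtain ⟨c, q, h⟩ := hS L hL _ hg
      exact hk q (Prod.ext_iff.1 h).2
  rw [propagate_snd]
  · simp [Fintype.sum_sum_type, h0]
  · intro L hL k hk L' hL' k' hk'
    obtain ⟨c, q, h⟩ := hS L hL _ hk
    obtain ⟨c', q', h'⟩ := hS L' hL' _ hk'
    simp_all

theorem IsZCircuit.propagate_snd_inr (hT : IsZCircuit T) (P : Pauli (Wire Q CX CZ)) (a : CX ⊕ CZ) :
    (propagate T P).2 (Sum.inr a) = P.2 (Sum.inr a) :=
  propagate_snd_of_forall_notMem (fun L hL k hk => by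
    obtain ⟨c, q, h⟩ := hT L hL _ hk
    simp at h) P

theorem IsZCircuit.propagate_fst_inl (hT : IsZCircuit T) (P : Pauli (Wire Q CX CZ)) (q : Q) :
    (propagate T P).1 (Sum.inl q) = P.1 (Sum.inl q) :=
  propagate_fst_of_forall_notMem (fun L hL k hk => by
    obtain ⟨c, q, h⟩ := hT L hL _ hk
    simp at h) P

theorem IsZCircuit.propagate_fst_inr_inl (hT : IsZCircuit T) (P : Pauli (Wire Q CX CZ)) (d : CX) :
    (propagate T P).1 (Sum.inr (Sum.inl d)) = P.1 (Sum.inr (Sum.inl d)) :=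
  propagate_fst_of_forall_notMem (fun L hL k hk => by
    obtain ⟨c, q, h⟩ := hT L hL _ hk
    simp at h) P

theorem IsZCircuit.propagate_snd_inl (hT : IsZCircuit T) (P : Pauli (Wire Q CX CZ)) (q : Q) :
    (propagate T P).2 (Sum.inl q) = P.2 (Sum.inl q) +
      ∑ c, P.2 (Sum.inr (Sum.inr c)) * flow T (Sum.inl q) (Sum.inr (Sum.inr c)) := by
  have h0 : ∀ k : Wire Q CX CZ, (∀ c, k ≠ Sum.inr (Sum.inr c)) → flow T (Sum.inl q) k = 0 :=
    fun k hk => flow_eq_zero fun L hL hg => by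
      obtain ⟨c, q, h⟩ := hT L hL _ hg
      exact hk c (Prod.ext_iff.1 h).2
  rw [propagate_snd]
  · simp [Fintype.sum_sum_type, h0]
  · intro L hL k hk L' hL' k' hk'
    obtain ⟨c, q, h⟩ := hT L hL _ hk
    obtain ⟨c', q', h'⟩ := hT L' hL' _ hk'
    simp_all

theorem IsZCircuit.propagate_fst_inr_inr (hT : IsZCircuit T) (P : Pauli (Wire Q CX CZ)) (c : CZ) :
    (propagate T P).1 (Sum.inr (Sum.inr c)) = P.1 (Sum.inr (Sum.inr c)) +
      ∑ q, P.1 (Sum.inl q) * flow T (Sum.inl q) (Sum.inr (Sum.inr c)) := by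
  have h0 : ∀ k : Wire Q CX CZ, (∀ q, k ≠ Sum.inl q) → flow T k (Sum.inr (Sum.inr c)) = 0 :=
    fun k hk => flow_eq_zero fun L hL hg => by
      obtain ⟨c, q, h⟩ := hT L hL _ hg
      exact hk q (Prod.ext_iff.1 h).1
  rw [propagate_fst]
  · simp [Fintype.sum_sum_type, h0]
  · intro L hL k hk L' hL' k' hk'
    obtain ⟨c, q, h⟩ := hT L hL _ hk
    obtain ⟨c', q', h'⟩ := hT L' hL' _ hk'
    simp_all

/-- X reaches data only from X-syndrome qubits, which are never targets; Z reaches data only from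
Z-syndrome qubits, which are never controls. Hence the order of the two circuits does not affect the
data. -/
theorem dataPart_propagate (hS : IsXCircuit S) (hT : IsZCircuit T) (hU : U ∈ [S ++ T, T ++ S])
    (P : Pauli (Wire Q CX CZ)) : dataPart (propagate U P) =
      (fun q => P.1 (Sum.inl q) +
        ∑ c, P.1 (Sum.inr (Sum.inl c)) * flow S (Sum.inr (Sum.inl c)) (Sum.inl q),
      fun q => P.2 (Sum.inl q) +
        ∑ c, P.2 (Sum.inr (Sum.inr c)) * flow T (Sum.inl q) (Sum.inr (Sum.inr c))) := by
  simp only [List.mem_cons, List.not_mem_nil, or_false] at hU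
  rcases hU with rfl | rfl <;>
    simp [dataPart, propagate_append, hS.propagate_fst_inl, hS.propagate_snd_inl,
      hT.propagate_fst_inl, hT.propagate_snd_inl, hS.propagate_snd_inr_inr,
      hT.propagate_fst_inr_inl]

/-- The syndrome operator spreads over its check and cancels the check operator on the data. A
syndrome qubit of the other type collects at most the overlap of an X-check with a Z-check, which is
even. -/
theorem CSSCode.isSyndromeExtraction (C : CSSCode Q CX CZ) (hS : IsXCircuit S)
    (hT : IsZCircuit T) (hS' : S.WellFormed) (hT' : T.WellFormed)
    (hSf : ∀ c q, flow S (Sum.inr (Sum.inl c)) (Sum.inl q) = C.HX c q)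
    (hTf : ∀ c q, flow T (Sum.inl q) (Sum.inr (Sum.inr c)) = C.HZ c q)
    (hU : U ∈ [S ++ T, T ++ S]) : C.IsSyndromeExtraction U := by
  have hcomm : ∀ c d, ∑ q, C.HX c q * C.HZ d q = 0 := fun c d => congrFun (congrFun C.comm c) d
  have hcomm' : ∀ c d, ∑ q, C.HZ d q * C.HX c q = 0 := fun c d => by
    simpa only [mul_comm] using hcomm c d
  simp only [List.mem_cons, List.not_mem_nil, or_false] at hU
  refine ⟨?_, fun c => ?_, fun c => ?_⟩
  · rcases hU with rfl | rfl <;> intro L hL <;> rcases List.mem_append.1 hL with hL | hL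
    exacts [hS' L hL, hT' L hL, hT' L hL, hS' L hL]
  all_goals
    rcases hU with rfl | rfl <;> rw [propagate_append] <;>
    refine Prod.ext (funext ?_) (funext ?_) <;> rintro (q | c' | d) <;>
    simp [hS.propagate_fst_inl, hS.propagate_snd_inl, hS.propagate_fst_inr,
      hT.propagate_fst_inl, hT.propagate_snd_inl, hS.propagate_snd_inr_inr,
      hS.propagate_snd_inr_inl, hT.propagate_snd_inr, hT.propagate_fst_inr_inr,
      hT.propagate_fst_inr_inl, hSf, hTf, hcomm, hcomm', Pi.single_apply,
      CharTwo.add_self_eq_zero]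

end Wires

namespace Reduction

variable {m₁ n₁ m₂ n₂ : ℕ} {H₁ : Matrix (Fin m₁) (Fin n₁) (ZMod 2)}
  {H₂ : Matrix (Fin m₂) (Fin n₂) (ZMod 2)} {R : Reduction H₁ H₂}

/-! ### Split schedules -/

theorem SplitX.isXCircuit (S : R.SplitX) : IsXCircuit S.circuit := fun L hL g hg => by
  obtain ⟨e, _, rfl⟩ := S.coloring.exists_of_mem_circuit _ hL hg
  exact ⟨e.1, e.2, rfl⟩

theorem SplitZ.isZCircuit (T : R.SplitZ) : IsZCircuit T.circuit := fun L hL g hg => by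
  obtain ⟨e, _, rfl⟩ := T.coloring.exists_of_mem_circuit _ hL hg
  exact ⟨e.1, e.2, rfl⟩

theorem SplitX.gate_injective : Function.Injective fun e : R.CheckX × R.Qubit =>
    ((Sum.inr (Sum.inl e.1), Sum.inl e.2) :
      Wire R.Qubit R.CheckX R.CheckZ × Wire R.Qubit R.CheckX R.CheckZ) :=
  fun _ _ h => Prod.ext (Sum.inl_injective (Sum.inr_injective (Prod.ext_iff.1 h).1))
    (Sum.inl_injective (Prod.ext_iff.1 h).2)

theorem SplitZ.gate_injective : Function.Injective fun e : R.CheckZ × R.Qubit =>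
    ((Sum.inl e.2, Sum.inr (Sum.inr e.1)) :
      Wire R.Qubit R.CheckX R.CheckZ × Wire R.Qubit R.CheckX R.CheckZ) :=
  fun _ _ h => Prod.ext (Sum.inr_injective (Sum.inr_injective (Prod.ext_iff.1 h).2))
    (Sum.inl_injective (Prod.ext_iff.1 h).1)

theorem isSyndromeExtraction (S : R.SplitX) (T : R.SplitZ)
    {U : Circuit (Wire R.Qubit R.CheckX R.CheckZ)}
    (hU : U ∈ [S.circuit ++ T.circuit, T.circuit ++ S.circuit]) :
    R.code.IsSyndromeExtraction U := by
  refine R.code.isSyndromeExtraction S.isXCircuit T.isZCircuit ?_ ?_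
    (fun c q => S.coloring.flow_circuit _ SplitX.gate_injective (c, q))
    (fun c q => T.coloring.flow_circuit _ SplitZ.gate_injective (c, q)) hU
  · exact S.coloring.wellFormed_circuit _ (fun _ _ h => Sum.inr_ne_inl h)
      (fun _ _ h => Or.inl (Sum.inl_injective (Sum.inr_injective h)))
      (fun _ _ h => Or.inr (Sum.inl_injective h))
  · exact T.coloring.wellFormed_circuit _ (fun _ _ h => Sum.inl_ne_inr h)
      (fun _ _ h => Or.inr (Sum.inl_injective h))
      (fun _ _ h => Or.inl (Sum.inr_injective (Sum.inr_injective h)))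

/-! ### Bit-type supports of the checks and hook errors -/

theorem HX_apply_inl (c : R.CheckX) (p : Fin n₁ × Fin n₂) :
    R.code.HX c (Sum.inl p) = (R.WX *ᵥ fun d => hgpX H₁ H₂ d (Sum.inl p)) c := by
  change (R.WX * hgpX H₁ H₂ * R.V) c (Sum.inl p) = _
  simp [V, mul_apply, mulVec, dotProduct, one_apply]

theorem HZ_apply_inl (c : R.CheckZ) (p : Fin n₁ × Fin n₂) :
    R.code.HZ c (Sum.inl p) = (R.WZ *ᵥ fun d => hgpZ H₁ H₂ d (Sum.inl p)) c := by
  change (R.WZ * hgpZ H₁ H₂ * R.V) c (Sum.inl p) = _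
  simp [V, mul_apply, mulVec, dotProduct, one_apply]

theorem HX_inl_inl (d : {d // ¬ R.MergedX d}) (i : Fin n₁) (j : Fin n₂) :
    R.code.HX (Sum.inl d) (Sum.inl (i, j)) =
      H₁ d.1.1 i * (1 : Matrix (Fin n₂) (Fin n₂) (ZMod 2)) d.1.2 j := by
  rw [HX_apply_inl, WX_mulVec_inl]
  rfl

theorem HX_inr_inl (r : R.CombX) (i : Fin n₁) (j : Fin n₂) :
    R.code.HX (Sum.inr r) (Sum.inl (i, j)) =
      H₁ r.1.1.1 i * (1 : Matrix (Fin n₂) (Fin n₂) (ZMod 2)) (R.colOf r false) j +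
      H₁ r.1.1.1 i * (1 : Matrix (Fin n₂) (Fin n₂) (ZMod 2)) (R.colOf r true) j := by
  rw [HX_apply_inl, WX_mulVec_inr]
  rfl

theorem HZ_inl_inl (d : {d // ¬ R.MergedZ d}) (i : Fin n₁) (j : Fin n₂) :
    R.code.HZ (Sum.inl d) (Sum.inl (i, j)) =
      (1 : Matrix (Fin n₁) (Fin n₁) (ZMod 2)) d.1.1 i * H₂ d.1.2 j := by
  rw [HZ_apply_inl, WZ_mulVec_inl]
  rfl

theorem HZ_inr_inl (r : R.CombZ) (i : Fin n₁) (j : Fin n₂) :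
    R.code.HZ (Sum.inr r) (Sum.inl (i, j)) =
      (1 : Matrix (Fin n₁) (Fin n₁) (ZMod 2)) (R.rowOf r false) i * H₂ r.1.1.2 j +
      (1 : Matrix (Fin n₁) (Fin n₁) (ZMod 2)) (R.rowOf r true) i * H₂ r.1.1.2 j := by
  rw [HZ_apply_inl, WZ_mulVec_inr]
  rfl

/-- In the first stage of the split schedule, and in the later ones, a check meets the bit-type
qubits in a single column. -/
theorem exists_column_of_stageX (flip : R.CombX → Bool) (c : R.CheckX) :
    (∃ j₀, ∀ i j, R.code.HX c (Sum.inl (i, j)) ≠ 0 → R.stageX flip c (Sum.inl (i, j)) = 0 →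
      j = j₀) ∧
    ∃ j₁, ∀ i j, R.code.HX c (Sum.inl (i, j)) ≠ 0 → R.stageX flip c (Sum.inl (i, j)) ≠ 0 →
      j = j₁ := by
  rcases c with d | r
  -- A non-combined check has all its bit-type qubits in one column, which serves both claims.
  · refine ⟨⟨d.1.2, fun i j h _ => ?_⟩, ⟨d.1.2, fun i j h _ => ?_⟩⟩ <;>
    · by_contra hj
      exact h (by rw [HX_inl_inl, one_apply_ne (Ne.symm hj), mul_zero])
  · refine ⟨⟨R.colOf r (flip r), fun i j _ h => ?_⟩, ⟨R.colOf r (!flip r), fun i j h h' => ?_⟩⟩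
    · by_contra hj
      simp [stageX, hj] at h
    · by_contra hj
      have hj' : j ≠ R.colOf r (flip r) := fun hj' => h' (by simp [stageX, hj'])
      have : ∀ s, R.colOf r s ≠ j := fun s => by
        rcases Bool.eq_or_eq_not s (flip r) with h | h
        · exact h ▸ Ne.symm hj'
        · exact h ▸ Ne.symm hj
      exact h (by rw [HX_inr_inl, one_apply_ne (this _), one_apply_ne (this _)]; simp)

theorem exists_row_of_stageZ (flip : R.CombZ → Bool) (c : R.CheckZ) :
    (∃ i₀, ∀ i j, R.code.HZ c (Sum.inl (i, j)) ≠ 0 → R.stageZ flip c (Sum.inl (i, j)) = 0 →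
      i = i₀) ∧
    ∃ i₁, ∀ i j, R.code.HZ c (Sum.inl (i, j)) ≠ 0 → R.stageZ flip c (Sum.inl (i, j)) ≠ 0 →
      i = i₁ := by
  rcases c with d | r
  · refine ⟨⟨d.1.1, fun i j h _ => ?_⟩, ⟨d.1.1, fun i j h _ => ?_⟩⟩ <;>
    · by_contra hi
      exact h (by rw [HZ_inl_inl, one_apply_ne (Ne.symm hi), zero_mul])
  · refine ⟨⟨R.rowOf r (flip r), fun i j _ h => ?_⟩, ⟨R.rowOf r (!flip r), fun i j h h' => ?_⟩⟩
    · by_contra hi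
      simp [stageZ, hi] at h
    · by_contra hi
      have hi' : i ≠ R.rowOf r (flip r) := fun hi' => h' (by simp [stageZ, hi'])
      have : ∀ s, R.rowOf r s ≠ i := fun s => by
        rcases Bool.eq_or_eq_not s (flip r) with h | h
        · exact h ▸ Ne.symm hi'
        · exact h ▸ Ne.symm hi
      exact h (by rw [HZ_inr_inl, one_apply_ne (this _), one_apply_ne (this _)]; simp)

/-- The gates of an `X`-check after some time act, up to the whole check, on a single column. -/
theorem SplitX.exists_column (S : R.SplitX) (c : R.CheckX) (t : ℕ) :
    ∃ (r : ZMod 2) (j₀ : Fin n₂), ∀ i j,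
      flow (S.circuit.drop t) (Sum.inr (Sum.inl c)) (Sum.inl (Sum.inl (i, j))) ≠
        r * R.code.HX c (Sum.inl (i, j)) → j = j₀ := by
  obtain ⟨⟨j₀, h₀⟩, j₁, h₁⟩ := R.exists_column_of_stageX S.flip c
  rcases S.coloring.flow_drop_circuit _ SplitX.gate_injective t with h | h
  -- After the first stage the remaining gates themselves lie in one column (r = 0); before its end,
  -- their complement in the check does (r = 1).
  · refine ⟨0, j₁, fun i j hij => ?_⟩
    rw [zero_mul] at hij
    obtain ⟨h2, h3⟩ := h (c, Sum.inl (i, j)) hij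
    exact h₁ i j h2 h3
  · refine ⟨1, j₀, fun i j hij => ?_⟩
    rw [one_mul] at hij
    obtain ⟨h2, h3⟩ := h (c, Sum.inl (i, j)) hij
    exact h₀ i j h2 h3

theorem SplitZ.exists_row (T : R.SplitZ) (c : R.CheckZ) (t : ℕ) :
    ∃ (r : ZMod 2) (i₀ : Fin n₁), ∀ i j,
      flow (T.circuit.drop t) (Sum.inl (Sum.inl (i, j))) (Sum.inr (Sum.inr c)) ≠
        r * R.code.HZ c (Sum.inl (i, j)) → i = i₀ := by
  obtain ⟨⟨i₀, h₀⟩, i₁, h₁⟩ := R.exists_row_of_stageZ T.flip c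
  rcases T.coloring.flow_drop_circuit _ SplitZ.gate_injective t with h | h
  · refine ⟨0, i₁, fun i j hij => ?_⟩
    rw [zero_mul] at hij
    obtain ⟨h2, h3⟩ := h (c, Sum.inl (i, j)) hij
    exact h₁ i j h2 h3
  · refine ⟨1, i₀, fun i j hij => ?_⟩
    rw [one_mul] at hij
    obtain ⟨h2, h3⟩ := h (c, Sum.inl (i, j)) hij
    exact h₀ i j h2 h3

theorem hooksInColumn (S : R.SplitX) (T : R.SplitZ)
    {U : Circuit (Wire R.Qubit R.CheckX R.CheckZ)}
    (hU : U ∈ [S.circuit ++ T.circuit, T.circuit ++ S.circuit]) : R.HooksInColumn U := by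
  rintro c t a b D rfl
  obtain ⟨s, s', hs⟩ := exists_drop_mem hU t
  obtain ⟨r, j₀, hr⟩ := S.exists_column c s
  rw [dataPart_propagate (S.isXCircuit.drop s) (T.isZCircuit.drop s') hs]
  refine ⟨by ext q; simp, ?_⟩
  -- Multiplication by the check is needed exactly when the fault has an X-part and r = 1.
  by_cases har : a * r = 0
  · refine ⟨_, Or.inl rfl, j₀, fun i j hij => hr i j fun h => hij ?_⟩
    simp [Pi.single_apply, h, ← mul_assoc, har]
  · refine ⟨_, Or.inr rfl, j₀, fun i j hij => hr i j fun h => hij ?_⟩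
    simp [Pi.single_apply, h, ← mul_assoc, eq_one_of_ne_zero har, CharTwo.add_self_eq_zero]

theorem hooksInRow (S : R.SplitX) (T : R.SplitZ)
    {U : Circuit (Wire R.Qubit R.CheckX R.CheckZ)}
    (hU : U ∈ [S.circuit ++ T.circuit, T.circuit ++ S.circuit]) : R.HooksInRow U := by
  rintro c t a b D rfl
  obtain ⟨s, s', hs⟩ := exists_drop_mem hU t
  obtain ⟨r, i₀, hr⟩ := T.exists_row c s'
  rw [dataPart_propagate (S.isXCircuit.drop s) (T.isZCircuit.drop s') hs]
  refine ⟨by ext q; simp, ?_⟩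
  by_cases hbr : b * r = 0
  · refine ⟨_, Or.inl rfl, i₀, fun i j hij => hr i j fun h => hij ?_⟩
    simp [Pi.single_apply, h, ← mul_assoc, hbr]
  · refine ⟨_, Or.inr rfl, i₀, fun i j hij => hr i j fun h => hij ?_⟩
    simp [Pi.single_apply, h, ← mul_assoc, eq_one_of_ne_zero hbr, CharTwo.add_self_eq_zero]

/-! ### The effective distance -/

theorem dataPart_finalError {Q A : Type*} [DecidableEq (Q ⊕ A)] (U : Circuit (Q ⊕ A))
    (F : Fin (U.length + 1) → Pauli (Q ⊕ A)) :
    dataPart (finalError U F) =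
      (fun q => ∑ t : Fin (U.length + 1), (dataPart (propagate (U.drop t) (F t))).1 q,
        fun q => ∑ t : Fin (U.length + 1), (dataPart (propagate (U.drop t) (F t))).2 q) := by
  simp [dataPart, finalError, Prod.fst_sum, Prod.snd_sum, Finset.sum_apply]

/-- A codeword read off, column by column, from the `X`-part of the final data error is supported
on the columns of the faults. -/
theorem card_le_faultCount_X (S : R.SplitX) (T : R.SplitZ)
    {U : Circuit (Wire R.Qubit R.CheckX R.CheckZ)}
    (hU : U ∈ [S.circuit ++ T.circuit, T.circuit ++ S.circuit])
    (F : Fin (U.length + 1) → Pauli (Wire R.Qubit R.CheckX R.CheckZ)) {v : Fin n₁ → ZMod 2}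
    (hv : H₁ *ᵥ v = 0) {w : Fin n₂ → ZMod 2}
    (hw : w = fun j => ∑ i, v i * (dataPart (finalError U F)).1 (Sum.inl (i, j))) :
    (Finset.univ.filter fun j => w j ≠ 0).card ≤ faultCount F := by
  have hpos : ∀ (t : Fin (U.length + 1)), ∃ s s',
      U.drop t ∈ [S.circuit.drop s ++ T.circuit.drop s', T.circuit.drop s' ++ S.circuit.drop s] :=
    fun t => exists_drop_mem hU t
  choose s s' hs using hpos
  choose r p hp using fun c t => S.exists_column c (s t)
  -- A fault on a bit-type qubit is charged to its column and one on an X-syndrome qubit to the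
  -- column of its hook. Check-type and Z-syndrome qubits put no X-error on bit-type qubits.
  refine card_support_le_faultCount F w (fun t => Sum.elim
    (Sum.elim (fun ij => some ij.2) fun _ => none) (Sum.elim (fun c => some (p c t)) fun _ => none))
    fun j hj => ?_
  by_contra! hcon
  refine hj ?_
  have h1 : ∀ t i, (F t).1 (Sum.inl (Sum.inl (i, j))) = 0 := fun t i => by
    by_contra h
    exact hcon t (Sum.inl (Sum.inl (i, j))) (Or.inl h) rfl
  -- With no fault charged to column j, every hook agrees there with a multiple of its check.
  have h2 : ∀ t c i, (F t).1 (Sum.inr (Sum.inl c)) *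
      flow (S.circuit.drop (s t)) (Sum.inr (Sum.inl c)) (Sum.inl (Sum.inl (i, j))) =
      (F t).1 (Sum.inr (Sum.inl c)) * r c t * R.code.HX c (Sum.inl (i, j)) := fun t c i => by
    by_cases h : (F t).1 (Sum.inr (Sum.inl c)) = 0
    · simp [h]
    · rw [mul_assoc]
      congr 1
      by_contra h'
      exact hcon t (Sum.inr (Sum.inl c)) (Or.inl h) (congrArg some (hp c t i j h').symm)
  rw [hw, dataPart_finalError]
  simp only [dataPart_propagate (S.isXCircuit.drop _) (T.isZCircuit.drop _) (hs _), h1, h2,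
    zero_add, Finset.mul_sum]
  rw [Finset.sum_comm]
  refine Finset.sum_eq_zero fun t _ => ?_
  rw [Finset.sum_comm]
  refine Finset.sum_eq_zero fun c _ => ?_
  -- The codeword v annihilates each X-check within column j.
  rw [← mul_zero ((F t).1 (Sum.inr (Sum.inl c)) * r c t), ← R.sum_mul_HX v hv c j, Finset.mul_sum]
  exact Finset.sum_congr rfl fun i _ => mul_left_comm _ _ _

/-- A codeword read off, row by row, from the `Z`-part of the final data error is supported on the
rows of the faults. -/
theorem card_le_faultCount_Z (S : R.SplitX) (T : R.SplitZ)
    {U : Circuit (Wire R.Qubit R.CheckX R.CheckZ)}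
    (hU : U ∈ [S.circuit ++ T.circuit, T.circuit ++ S.circuit])
    (F : Fin (U.length + 1) → Pauli (Wire R.Qubit R.CheckX R.CheckZ)) {v : Fin n₂ → ZMod 2}
    (hv : H₂ *ᵥ v = 0) {w : Fin n₁ → ZMod 2}
    (hw : w = fun i => ∑ j, v j * (dataPart (finalError U F)).2 (Sum.inl (i, j))) :
    (Finset.univ.filter fun i => w i ≠ 0).card ≤ faultCount F := by
  have hpos : ∀ (t : Fin (U.length + 1)), ∃ s s',
      U.drop t ∈ [S.circuit.drop s ++ T.circuit.drop s', T.circuit.drop s' ++ S.circuit.drop s] :=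
    fun t => exists_drop_mem hU t
  choose s s' hs using hpos
  choose r p hp using fun c t => T.exists_row c (s' t)
  refine card_support_le_faultCount F w (fun t => Sum.elim
    (Sum.elim (fun ij => some ij.1) fun _ => none) (Sum.elim (fun _ => none) fun c => some (p c t)))
    fun i hi => ?_
  by_contra! hcon
  refine hi ?_
  have h1 : ∀ t j, (F t).2 (Sum.inl (Sum.inl (i, j))) = 0 := fun t j => by
    by_contra h
    exact hcon t (Sum.inl (Sum.inl (i, j))) (Or.inr h) rfl
  have h2 : ∀ t c j, (F t).2 (Sum.inr (Sum.inr c)) *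
      flow (T.circuit.drop (s' t)) (Sum.inl (Sum.inl (i, j))) (Sum.inr (Sum.inr c)) =
      (F t).2 (Sum.inr (Sum.inr c)) * r c t * R.code.HZ c (Sum.inl (i, j)) := fun t c j => by
    by_cases h : (F t).2 (Sum.inr (Sum.inr c)) = 0
    · simp [h]
    · rw [mul_assoc]
      congr 1
      by_contra h'
      exact hcon t (Sum.inr (Sum.inr c)) (Or.inr h) (congrArg some (hp c t i j h').symm)
  rw [hw, dataPart_finalError]
  simp only [dataPart_propagate (S.isXCircuit.drop _) (T.isZCircuit.drop _) (hs _), h1, h2,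
    zero_add, Finset.mul_sum]
  rw [Finset.sum_comm]
  refine Finset.sum_eq_zero fun t _ => ?_
  rw [Finset.sum_comm]
  refine Finset.sum_eq_zero fun c _ => ?_
  rw [← mul_zero ((F t).2 (Sum.inr (Sum.inr c)) * r c t), ← R.sum_mul_HZ v hv c i, Finset.mul_sum]
  exact Finset.sum_congr rfl fun j _ => mul_left_comm _ _ _

/-- An undetectable error has a nontrivial X-part or Z-part; the weight of the codeword read off
that part lies between the distance and the fault count. -/
theorem distance_le_effectiveDistance (hH₁ : LinearIndependent (ZMod 2) H₁.row)
    (hH₂ : LinearIndependent (ZMod 2) H₂.row) (S : R.SplitX) (T : R.SplitZ)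
    {U : Circuit (Wire R.Qubit R.CheckX R.CheckZ)}
    (hU : U ∈ [S.circuit ++ T.circuit, T.circuit ++ S.circuit]) :
    R.code.distance ≤ R.code.effectiveDistance U := by
  refine le_iInf₂ fun F hF => ?_
  obtain ⟨hx, hz, hst⟩ := hF
  by_cases hX : (dataPart (finalError U F)).1 ∈ Submodule.span (ZMod 2) (Set.range R.code.HX.row)
  · obtain ⟨v, w, hv, hw, hw0, hwv⟩ := R.exists_codeword_Z hH₂ _ hz fun hZ => hst ⟨hX, hZ⟩
    have hv0 : v ≠ 0 := fun h => hw0 (by rw [hwv, h]; ext; simp)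
    exact (R.distance_le_card_left hw hv hw0 hv0).trans
      (Nat.cast_le.2 (card_le_faultCount_Z S T hU F hv hwv))
  · obtain ⟨v, w, hv, hw, hw0, hwv⟩ := R.exists_codeword_X hH₁ _ hx hX
    have hv0 : v ≠ 0 := fun h => hw0 (by rw [hwv, h]; ext; simp)
    exact (R.distance_le_card_right hv hw hv0 hw0).trans
      (Nat.cast_le.2 (card_le_faultCount_X S T hU F hv hwv))

end Reduction

theorem linearIndependent_row_of_rank_eq {m n : ℕ} {H : Matrix (Fin m) (Fin n) (ZMod 2)}
    (h : H.rank = m) : LinearIndependent (ZMod 2) H.row := by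
  rw [linearIndependent_iff_card_eq_finrank_span, Set.finrank, ← Matrix.rank_eq_finrank_span_row, h,
    Fintype.card_fin]

end HGPReduction

theorem mainTheorem4 {m₁ n₁ m₂ n₂ : ℕ}
    (H₁ : Matrix (Fin m₁) (Fin n₁) (ZMod 2)) (H₂ : Matrix (Fin m₂) (Fin n₂) (ZMod 2))
    (hH₁ : H₁.rank = m₁) (hH₂ : H₂.rank = m₂) (R : HGPReduction.Reduction H₁ H₂) :
    (∃ (S : R.SplitX) (T : R.SplitZ), S.coloring.IsMinimum ∧ T.coloring.IsMinimum) ∧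
    ∀ (S : R.SplitX) (T : R.SplitZ),
      ∀ U ∈ [S.circuit ++ T.circuit, T.circuit ++ S.circuit],
        R.code.IsDistancePreserving U ∧ R.HooksInColumn U ∧ R.HooksInRow U := by
  refine ⟨?_, fun S T U hU => ⟨⟨HGPReduction.Reduction.isSyndromeExtraction S T hU,
    le_antisymm (R.code.effectiveDistance_le_distance U)
      (HGPReduction.Reduction.distance_le_effectiveDistance
        (HGPReduction.linearIndependent_row_of_rank_eq hH₁)
        (HGPReduction.linearIndependent_row_of_rank_eq hH₂) S T hU)⟩,
    HGPReduction.Reduction.hooksInColumn S T hU, HGPReduction.Reduction.hooksInRow S T hU⟩⟩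
  obtain ⟨S, hS⟩ := HGPReduction.StageColoring.exists_isMinimum R.code.HX
    (R.stageX fun _ => false)
  obtain ⟨T, hT⟩ := HGPReduction.StageColoring.exists_isMinimum R.code.HZ
    (R.stageZ fun _ => false)
  exact ⟨⟨_, S⟩, ⟨_, T⟩, hS, hT⟩
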